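/- Let $X$ be a locally compact Hausdorff space with Borel $\sigma$-algebra $\Sigma_X$, let $\mathcal C_X$ be the family of open subsets of $X$ with compact closure, let $\mathcal H$ be a complex Hilbert space, and let $\mathcal B\subset B(\mathcal H)$ be a hereditary $C^*$-subalgebra (norm-closed $*$-subalgebra such that $0\le b\le a$, $a\in\mathcal B$ imply $b\in\mathcal B$). Let $\{A_\hbar\}_{\hbar\in(0,1]}$ be a locally $\mathcal B$-valued Borel asymptotic spectral measure on $X$, that is: each $A_\hbar:\Sigma_X\to B(\mathcal H)$ is a positive operator-valued measure (countably additive in the weak operator topology), $A_\hbar(U)\in\mathcal B$ for all $U\in\mathcal C_X$, $\limsup_{\hbar\to0}\|A_\hbar(X)\|\le1$, the map $\hbar\mapsto A_\hbar(U)$ is norm continuous on $(0,1]$ for each $U\in\mathcal C_X$, and $\lim_{\hbar\to0}\|A_\hbar(U_1\cap U_2)-A_\hbar(U_1)A_\hbar(U_2)\|=0$ for all $U_1,U_2\in\mathcal C_X$. Suppose that $\{A_\hbar\}$ is injective: $\liminf_{\hbar\to0}\|A_\hbar(U)\|>0$ for every nonempty $U\in\mathcal C_X$. Then the weak integrals $Q_\hbar(f)=\int_X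 f\,dA_\hbar$, defined by $\langle Q_\hbar(f)v,w\rangle=\int_X f\,d\langle A_\hbar(\cdot)v,w\rangle$ for all $v,w\in\mathcal H$, define linear maps $Q_\hbar:C_0(X)\to\mathcal B$, $\hbar\in(0,1]$, such that: 1. Each $Q_\hbar$ is positive; $\lim_{\hbar\to0}\|Q_\hbar(fg)-Q_\hbar(f)Q_\hbar(g)\|=0$ for all $f,g\in C_0(X)$; and there is $\hbar_0\in(0,1]$ such that $\hbar\mapsto Q_\hbar(f)$ is continuous on $(0,\hbar_0]$ for every $f\in C_0(X)$. If moreover $\hbar\mapsto\|A_\hbar(X)\|$ is locally bounded on $(0,1]$ (for instance if $X$ is compact or all $A_\hbar(X)=I$), then $\hbar\mapsto Q_\hbar(f)$ is continuous on $(0,1]$ for every $f$, so that $\{Q_\hbar\}$ is a positive asymptotic morphism $C_0(X)\to\mathcal B$ parameterized by $(0,1]$. 2. $\{Q_\hbar\}$ is injective: $\liminf_{\hbar\to0}\|Q_\hbar(f)\|>0$ for every $f\ne0$ in $C_0(X)$. 3. $\|f\|=\lim_{\hbar\to0}\|Q_\hbar(f)\|$ for every $f\in C_0(X)$. 4. There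 is an associated strong deformation from $X$ to $\mathcal B$: a continuous field of $C^*$-algebras over $[0,1]$ with fiber $C_0(X)$ at $0$ whose restriction to $(0,1]$ is isomorphic to the trivial field $\mathcal B\times(0,1]$, and whose continuous sections are, under these identifications, exactly the vector fields $s$ with $\hbar\mapsto s(\hbar)\in\mathcal B$ continuous on $(0,1]$ and $\lim_{\hbar\to0}\|s(\hbar)-Q_\hbar(s(0))\|=0$. -/

import Mathlib

open Filter Topology MeasureTheory
open scoped ENNReal InnerProductSpace ZeroAtInfty

universe u v

/-- The parameter space `(0, 1]` of the deformation parameter `ħ`. -/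
abbrev Planck : Type := Set.Ioc (0 : ℝ) 1

namespace Planck

/-- The filter `ħ → 0` on `(0, 1]`. -/
def toZero : Filter Planck := comap (fun ħ : Planck => (ħ : ℝ)) (𝓝 0)

/-- The inclusion of `(0, 1]` into `[0, 1]`. -/
def toI (ħ : Planck) : unitInterval := ⟨ħ.1, ħ.2.1.le, ħ.2.2⟩

end Planck

/-! ### Positive operator-valued measures -/

/-- A positive operator-valued measure on a measurable space: `A ∅ = 0`, `A Δ ≥ 0`, and
countable additivity in the weak operator topology. Only the values on measurable sets matter. -/
structure POVM (X : Type u) [MeasurableSpace X]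
    (H : Type v) [NormedAddCommGroup H] [InnerProductSpace ℂ H] where
  toFun : Set X → (H →L[ℂ] H)
  empty' : toFun ∅ = 0
  nonneg' : ∀ Δ, MeasurableSet Δ → 0 ≤ toFun Δ
  iUnion' : ∀ Δ : ℕ → Set X, (∀ n, MeasurableSet (Δ n)) → Pairwise (fun i j => Disjoint (Δ i) (Δ j)) →
    ∀ x y : H, HasSum (fun n => ⟪x, toFun (Δ n) y⟫_ℂ) ⟪x, toFun (⋃ n, Δ n) y⟫_ℂ

namespace POVM

variable {X : Type u} [MeasurableSpace X]
  {H : Type v} [NormedAddCommGroup H] [InnerProductSpace ℂ H]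

instance : CoeFun (POVM X H) (fun _ => Set X → (H →L[ℂ] H)) := ⟨toFun⟩

lemma re_inner_nonneg (A : POVM X H) (x : H) {Δ : Set X} (hΔ : MeasurableSet Δ) :
    0 ≤ (⟪x, A Δ x⟫_ℂ).re :=
  ((ContinuousLinearMap.nonneg_iff_isPositive _).1 (A.nonneg' Δ hΔ)).re_inner_nonneg_right x

/-- The finite positive measure `Δ ↦ ⟨A(Δ) x, x⟩`. -/
noncomputable def diagMeasure (A : POVM X H) (x : H) : Measure X :=
  Measure.ofMeasurable (fun Δ _ => ENNReal.ofReal (⟪x, A Δ x⟫_ℂ).re)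
    (by simp [A.empty'])
    (by
      intro Δ hΔ hd
      have h := Complex.hasSum_re (A.iUnion' Δ hΔ hd x x)
      rw [← h.tsum_eq]
      exact ENNReal.ofReal_tsum_of_nonneg (fun n => A.re_inner_nonneg x (hΔ n)) h.summable)

/-- The integral `∫ f d⟨A(·) x, y⟩` of `f` against the complex measure `Δ ↦ ⟨A(Δ) x, y⟩` (linear
in `x`, conjugate linear in `y`), this complex measure being written by polarization as
`(1/4) ∑ₖ iᵏ ⟨A(·) (x + iᵏ y), x + iᵏ y⟩`, a combination of four finite positive measures. -/
noncomputable def formIntegral (A : POVM X H) (f : X → ℂ) (x y : H) : ℂ :=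
  ((∫ t, f t ∂(A.diagMeasure (x + y))) - (∫ t, f t ∂(A.diagMeasure (x - y)))
    + Complex.I * (∫ t, f t ∂(A.diagMeasure (x + Complex.I • y)))
    - Complex.I * (∫ t, f t ∂(A.diagMeasure (x - Complex.I • y)))) / 4

/-- `T = ∫ f dA` in the weak sense: `⟨T x, y⟩ = ∫ f d⟨A(·) x, y⟩` for all `x`, `y`
(`f` bounded and measurable). This determines `T`. Mathlib's inner product is conjugate linear
in its first argument. -/
def IsIntegral (A : POVM X H) (f : X → ℂ) (T : H →L[ℂ] H) : Prop :=
  ∀ x y : H, ⟪y, T x⟫_ℂ = A.formIntegral f x y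

end POVM

/-! ### Asymptotic spectral measures -/

section ASM

variable {X : Type u} [MeasurableSpace X]
  {H : Type v} [NormedAddCommGroup H] [InnerProductSpace ℂ H]

/-- An asymptotic spectral measure with asymptotic carrier `ℰ`. The `limsup` is taken in `[0, ∞]`,
so that its bound forces `‖A ħ X‖` to be bounded as `ħ → 0`. -/
structure IsASM (ℰ : Set (Set X)) (A : Planck → POVM X H) : Prop where
  limsup_le : limsup (fun ħ => ‖A ħ Set.univ‖ₑ) Planck.toZero ≤ 1
  continuous : ∀ Δ ∈ ℰ, Continuous fun ħ => A ħ Δ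
  proj : ∀ Δ₁ ∈ ℰ, ∀ Δ₂ ∈ ℰ,
    Tendsto (fun ħ => ‖A ħ (Δ₁ ∩ Δ₂) - A ħ Δ₁ * A ħ Δ₂‖) Planck.toZero (𝓝 0)

/-- An asymptotic spectral measure is injective if `liminf ‖A ħ Δ‖ > 0` for every nonempty
set `Δ` in the asymptotic carrier. -/
def IsInjectiveASM (ℰ : Set (Set X)) (A : Planck → POVM X H) : Prop :=
  ∀ Δ ∈ ℰ, Δ.Nonempty → 0 < liminf (fun ħ => ‖A ħ Δ‖ₑ) Planck.toZero

end ASM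

/-- The pre-compact open subsets of a space. -/
def precompactOpens (X : Type u) [TopologicalSpace X] : Set (Set X) :=
  {U | IsOpen U ∧ IsCompact (closure U)}

section Hereditary

variable {H : Type v} [NormedAddCommGroup H] [InnerProductSpace ℂ H] [CompleteSpace H]

/-- A `*`-subalgebra `B` of the bounded operators is hereditary if `0 ≤ b ≤ a` and `a ∈ B` imply
`b ∈ B`. -/
def IsHereditary (B : NonUnitalStarSubalgebra ℂ (H →L[ℂ] H)) : Prop :=
  ∀ a b : H →L[ℂ] H, 0 ≤ b → b ≤ a → a ∈ B → b ∈ B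

/-- A family of Borel POVMs is locally `B`-valued if it maps pre-compact open sets into `B`. -/
def IsLocallyValued {X : Type u} [TopologicalSpace X] [MeasurableSpace X]
    (B : NonUnitalStarSubalgebra ℂ (H →L[ℂ] H)) (A : Planck → POVM X H) : Prop :=
  ∀ ħ, ∀ U ∈ precompactOpens X, A ħ U ∈ B

end Hereditary

/-! ### Asymptotic morphisms -/

section Morphisms

variable {𝒜 : Type u} {ℬ : Type v} [NonUnitalCStarAlgebra 𝒜] [NonUnitalCStarAlgebra ℬ]

/-- A linear map of C⋆-algebras is positive if it maps positive elements to positive elements;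
the positive elements of a C⋆-algebra are those of the form `a⋆ a`. -/
def IsPositiveMap (Q : 𝒜 →ₗ[ℂ] ℬ) : Prop :=
  ∀ a : 𝒜, ∃ b : ℬ, Q (star a * a) = star b * b

/-- A family of linear maps `Q ħ`, `ħ ∈ (0, 1]`, that are positive and asymptotically
multiplicative as `ħ → 0`, and for which `ħ ↦ Q ħ a` is continuous on `S ⊆ (0, 1]`. -/
structure IsPositiveAsymptoticMorphismOn (S : Set Planck) (Q : Planck → 𝒜 →ₗ[ℂ] ℬ) : Prop where
  positive : ∀ ħ, IsPositiveMap (Q ħ)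
  continuousOn : ∀ a, ContinuousOn (fun ħ => Q ħ a) S
  mul : ∀ a b, Tendsto (fun ħ => ‖Q ħ (a * b) - Q ħ a * Q ħ b‖) Planck.toZero (𝓝 0)

/-- A positive asymptotic morphism: continuity holds on the whole of `(0, 1]`. -/
def IsPositiveAsymptoticMorphism (Q : Planck → 𝒜 →ₗ[ℂ] ℬ) : Prop :=
  IsPositiveAsymptoticMorphismOn Set.univ Q

/-- Injectivity of an asymptotic morphism: `liminf ‖Q ħ a‖ > 0` for every `a ≠ 0`. -/
def IsInjectiveAsymptotic (Q : Planck → 𝒜 →ₗ[ℂ] ℬ) : Prop :=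
  ∀ a, a ≠ 0 → 0 < liminf (fun ħ => ‖Q ħ a‖ₑ) Planck.toZero

end Morphisms

/-- `C₀(X)` as a C⋆-algebra. -/
noncomputable instance instCStarZeroAtInfty {X : Type u} [TopologicalSpace X] :
    NonUnitalCStarAlgebra C₀(X, ℂ) where

/-! ### Continuous fields of C⋆-algebras and strong deformations -/

/-- A continuous field of C⋆-algebras over `T` with fibers `F t`: a `*`-algebra of vector fields
(the continuous sections) whose values are dense in each fiber, whose norms are continuous
functions, and which is closed under local uniform approximation. -/
structure ContinuousField (T : Type u) [TopologicalSpace T] (F : T → Type v)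
    [∀ t, NonUnitalCStarAlgebra (F t)] where
  sections : NonUnitalStarSubalgebra ℂ (∀ t, F t)
  dense_values : ∀ t, Dense {a : F t | ∃ s ∈ sections, s t = a}
  continuous_norm : ∀ s ∈ sections, Continuous fun t => ‖s t‖
  mem_of_locally_approx : ∀ x : (∀ t, F t),
    (∀ t, ∀ ε > 0, ∃ s ∈ sections, ∀ᶠ t' in 𝓝 t, ‖x t' - s t'‖ ≤ ε) → x ∈ sections

/-- The continuous sections of the restriction of a continuous field along an open embedding `ι`:
the vector fields that are locally uniform limits of restrictions of continuous sections. -/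
def ContinuousField.restrictSections {T : Type u} [TopologicalSpace T] {F : T → Type v}
    [∀ t, NonUnitalCStarAlgebra (F t)] (E : ContinuousField T F)
    {S : Type*} [TopologicalSpace S] (ι : S → T) : Set (∀ s, F (ι s)) :=
  {x | ∀ s, ∀ ε > 0, ∃ σ ∈ E.sections, ∀ᶠ s' in 𝓝 s, ‖x s' - σ (ι s')‖ ≤ ε}

/-- A strong deformation from `X` to `B`: a continuous field of C⋆-algebras over `[0, 1]` with
fiber `C₀(X)` at `0`, whose restriction to `(0, 1]` is isomorphic to the trivial field
`B × (0, 1]` (whose continuous sections are the continuous functions `(0, 1] → B`). -/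
structure StrongDeformation (X : Type u) [TopologicalSpace X]
    (B : Type v) [NonUnitalCStarAlgebra B] where
  fiber : unitInterval → Type (max u v)
  [inst : ∀ t, NonUnitalCStarAlgebra (fiber t)]
  field : ContinuousField unitInterval fiber
  zeroIso : fiber 0 ≃⋆ₐ[ℂ] C₀(X, ℂ)
  posIso : ∀ ħ : Planck, fiber ħ.toI ≃⋆ₐ[ℂ] B
  trivial_on_pos : ∀ x : (∀ ħ : Planck, fiber ħ.toI),
    x ∈ field.restrictSections Planck.toI ↔ Continuous fun ħ => posIso ħ (x ħ)

attribute [instance] StrongDeformation.inst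

/-- The strong deformation `D` is the one associated to the family `Q`: a vector field `s` over
`[0, 1]` is a continuous section if and only if it is continuous on `(0, 1]` and
`‖s(ħ) - Q ħ (s(0))‖ → 0` as `ħ → 0`. -/
def StrongDeformation.IsAssociated {X : Type u} [TopologicalSpace X]
    {B : Type v} [NonUnitalCStarAlgebra B] (D : StrongDeformation X B)
    (Q : Planck → C₀(X, ℂ) →ₗ[ℂ] B) : Prop :=
  ∀ s : (∀ t, D.fiber t), s ∈ D.field.sections ↔
    (Continuous fun ħ : Planck => D.posIso ħ (s ħ.toI)) ∧
    Tendsto (fun ħ : Planck => ‖D.posIso ħ (s ħ.toI) - Q ħ (D.zeroIso (s 0))‖)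
      Planck.toZero (𝓝 0)

/-! The layers of the positive and negative parts of the real and imaginary parts of `f` in `C₀(X)`
are strict superlevel sets at positive heights, hence pre-compact open sets, so `f` is a uniform
limit of linear combinations of their indicators (`ZeroAtInftyContinuousMap.isPrecompactApprox`).
The integral of such a combination is the same combination of the operators `A ħ U`. It therefore
lies in `B`, varies continuously with `ħ`, and is asymptotically multiplicative, because products of
indicators are indicators of intersections.

Integrals obey `‖∫ f dA‖ ≤ 2 ‖f‖ ‖A(X)‖` (`POVM.IsIntegral.norm_le`), so these properties pass to
`f`. Existence and membership in the closed set `B` need only the finite mass of one POVM.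
Continuity needs locally bounded masses, and multiplicativity needs bounded masses near `0`, which
the `limsup` condition provides.

For the norm, `A ħ U` is positive and asymptotically idempotent, so its norm tends to `1` once it
stays away from `0`. Squeezing `|f|²` between `r 1_U`, with `U = {|f|² > r}` and `r < ‖f‖²`, and the
constant `‖f‖²` gives `‖Q ħ (|f|²)‖ → ‖f‖²`. The C⋆-identity and asymptotic multiplicativity turn
this into `‖Q ħ f‖ → ‖f‖`, from which injectivity follows.

Norm convergence also makes the norms of the sections prescribed by `Q` continuous at `0`, which is
the essential point in gluing the continuous field (`gluedField`). -/

/-! ### Bounded measurable functions -/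

section BddMeasurable

variable {X : Type u} [MeasurableSpace X]

/-- A function that is measurable and bounded. -/
def BddMeasurable (f : X → ℂ) : Prop := Measurable f ∧ ∃ C, ∀ t, ‖f t‖ ≤ C

lemma BddMeasurable.integrable {f : X → ℂ} (hf : BddMeasurable f) (μ : Measure X)
    [IsFiniteMeasure μ] : Integrable f μ :=
  Integrable.of_bound hf.1.aestronglyMeasurable hf.2.choose (ae_of_all _ hf.2.choose_spec)

lemma BddMeasurable.add {f g : X → ℂ} (hf : BddMeasurable f) (hg : BddMeasurable g) :
    BddMeasurable (f + g) := by
  obtain ⟨hf, C, hC⟩ := hf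
  obtain ⟨hg, D, hD⟩ := hg
  exact ⟨hf.add hg, C + D, fun t => (norm_add_le _ _).trans (add_le_add (hC t) (hD t))⟩

lemma BddMeasurable.smul {f : X → ℂ} (hf : BddMeasurable f) (c : ℂ) :
    BddMeasurable (c • f) := by
  obtain ⟨hf, C, hC⟩ := hf
  refine ⟨hf.const_smul c, ‖c‖ * C, fun t => ?_⟩
  rw [Pi.smul_apply, norm_smul]
  gcongr
  exact hC t

lemma BddMeasurable.sub {f g : X → ℂ} (hf : BddMeasurable f) (hg : BddMeasurable g) :
    BddMeasurable (f - g) := by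
  simpa [sub_eq_add_neg] using hf.add (hg.smul (-1))

lemma BddMeasurable.mul {f g : X → ℂ} (hf : BddMeasurable f) (hg : BddMeasurable g) :
    BddMeasurable (f * g) := by
  obtain ⟨hf, C, hC⟩ := hf
  obtain ⟨hg, D, hD⟩ := hg
  refine ⟨hf.mul hg, C * D, fun t => ?_⟩
  rw [Pi.mul_apply, norm_mul]
  exact mul_le_mul (hC t) (hD t) (norm_nonneg _) ((norm_nonneg _).trans (hC t))

lemma BddMeasurable.indicator {Δ : Set X} (hΔ : MeasurableSet Δ) :
    BddMeasurable (Δ.indicator (1 : X → ℂ)) := by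
  refine ⟨measurable_one.indicator hΔ, 1, fun t => ?_⟩
  by_cases h : t ∈ Δ <;> simp [h]

end BddMeasurable

/-! ### Weak integrals against a single POVM -/

namespace POVM

section Diag

variable {X : Type u} [MeasurableSpace X]
  {H : Type v} [NormedAddCommGroup H] [InnerProductSpace ℂ H]

lemma diagMeasure_apply (A : POVM X H) (x : H) {Δ : Set X} (hΔ : MeasurableSet Δ) :
    A.diagMeasure x Δ = ENNReal.ofReal (⟪x, A Δ x⟫_ℂ).re :=
  Measure.ofMeasurable_apply Δ hΔ

instance (A : POVM X H) (x : H) : IsFiniteMeasure (A.diagMeasure x) :=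
  ⟨by rw [diagMeasure_apply A x MeasurableSet.univ]; exact ENNReal.ofReal_lt_top⟩

lemma diagMeasure_real_apply (A : POVM X H) (x : H) {Δ : Set X} (hΔ : MeasurableSet Δ) :
    (A.diagMeasure x).real Δ = (⟪x, A Δ x⟫_ℂ).re := by
  rw [Measure.real, diagMeasure_apply A x hΔ, ENNReal.toReal_ofReal (A.re_inner_nonneg x hΔ)]

lemma coe_diagMeasure_real_apply (A : POVM X H) (x : H) {Δ : Set X} (hΔ : MeasurableSet Δ) :
    (((A.diagMeasure x).real Δ : ℝ) : ℂ) = ⟪x, A Δ x⟫_ℂ := by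
  rw [diagMeasure_real_apply A x hΔ]
  have h := ((ContinuousLinearMap.nonneg_iff_isPositive _).1 (A.nonneg' Δ hΔ)).inner_nonneg_right x
  exact (Complex.eq_re_of_ofReal_le (r := 0) (by simpa using h)).symm

lemma diagMeasure_real_univ_le (A : POVM X H) (x : H) :
    (A.diagMeasure x).real Set.univ ≤ ‖A Set.univ‖ * ‖x‖ ^ 2 := by
  rw [diagMeasure_real_apply A x MeasurableSet.univ]
  calc (⟪x, A Set.univ x⟫_ℂ).re ≤ ‖⟪x, A Set.univ x⟫_ℂ‖ := Complex.re_le_norm _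
    _ ≤ ‖x‖ * ‖A Set.univ x‖ := norm_inner_le_norm _ _
    _ ≤ ‖x‖ * (‖A Set.univ‖ * ‖x‖) := by gcongr; exact (A Set.univ).le_opNorm x
    _ = _ := by ring

lemma diagMeasure_smul (A : POVM X H) (c : ℂ) (x : H) :
    A.diagMeasure (c • x) = ENNReal.ofReal (‖c‖ ^ 2) • A.diagMeasure x := by
  ext Δ hΔ
  rw [Measure.smul_apply, diagMeasure_apply _ _ hΔ, diagMeasure_apply _ _ hΔ, smul_eq_mul,
    ← ENNReal.ofReal_mul (by positivity), map_smul, inner_smul_left, inner_smul_right, ← mul_assoc,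
    ← Complex.normSq_eq_conj_mul_self, Complex.normSq_eq_norm_sq, Complex.re_ofReal_mul]

lemma integral_diagMeasure_smul (A : POVM X H) (f : X → ℂ) (c : ℂ) (x : H) :
    ∫ t, f t ∂(A.diagMeasure (c • x)) = (‖c‖ ^ 2 : ℝ) * ∫ t, f t ∂(A.diagMeasure x) := by
  rw [diagMeasure_smul, integral_smul_measure, ENNReal.toReal_ofReal (by positivity),
    Complex.real_smul]

lemma formIntegral_self (A : POVM X H) (f : X → ℂ) (x : H) :
    A.formIntegral f x x = ∫ t, f t ∂(A.diagMeasure x) := by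
  have h1 : ‖(1 : ℂ) + Complex.I‖ ^ 2 = 2 := by
    rw [← Complex.normSq_eq_norm_sq]; simp [Complex.normSq_apply]; norm_num
  have h2 : ‖(1 : ℂ) - Complex.I‖ ^ 2 = 2 := by
    rw [← Complex.normSq_eq_norm_sq]; simp [Complex.normSq_apply]; norm_num
  have e1 : x + x = (2 : ℂ) • x := (two_smul ℂ x).symm
  have e2 : x - x = (0 : ℂ) • x := by simp
  have e3 : x + Complex.I • x = ((1 : ℂ) + Complex.I) • x := by rw [add_smul, one_smul]
  have e4 : x - Complex.I • x = ((1 : ℂ) - Complex.I) • x := by rw [sub_smul, one_smul]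
  rw [formIntegral, e1, e2, e3, e4]
  simp only [integral_diagMeasure_smul, h1, h2]
  norm_num

lemma formIntegral_add (A : POVM X H) {f g : X → ℂ} (hf : BddMeasurable f)
    (hg : BddMeasurable g) (x y : H) :
    A.formIntegral (f + g) x y = A.formIntegral f x y + A.formIntegral g x y := by
  simp only [formIntegral, Pi.add_apply]
  rw [integral_add (hf.integrable _) (hg.integrable _),
    integral_add (hf.integrable _) (hg.integrable _),
    integral_add (hf.integrable _) (hg.integrable _),
    integral_add (hf.integrable _) (hg.integrable _)]
  ring

lemma formIntegral_smul (A : POVM X H) (c : ℂ) (f : X → ℂ) (x y : H) :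
    A.formIntegral (c • f) x y = c * A.formIntegral f x y := by
  simp only [formIntegral, Pi.smul_apply, smul_eq_mul, integral_const_mul]
  ring

lemma norm_integral_diagMeasure_le (A : POVM X H) {f : X → ℂ} {M : ℝ} (hM : 0 ≤ M)
    (hf : ∀ t, ‖f t‖ ≤ M) (x : H) :
    ‖∫ t, f t ∂(A.diagMeasure x)‖ ≤ M * ‖A Set.univ‖ * ‖x‖ ^ 2 := by
  refine (norm_integral_le_of_norm_le_const (ae_of_all _ hf)).trans ?_
  rw [mul_assoc]
  exact mul_le_mul_of_nonneg_left (A.diagMeasure_real_univ_le x) hM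

/-- Each diagonal integral is bounded by a multiple of the squared norm of its vector; two
parallelogram laws add up the four squares and cancel the `4` of polarization. -/
lemma norm_formIntegral_le (A : POVM X H) {f : X → ℂ} {M : ℝ} (hM : 0 ≤ M)
    (hf : ∀ t, ‖f t‖ ≤ M) (x y : H) :
    ‖A.formIntegral f x y‖ ≤ M * ‖A Set.univ‖ * (‖x‖ ^ 2 + ‖y‖ ^ 2) := by
  have h1 := parallelogram_law_with_norm ℂ x y
  have h2 := parallelogram_law_with_norm ℂ x (Complex.I • y)
  rw [norm_smul, Complex.norm_I, one_mul] at h2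
  have b := A.norm_integral_diagMeasure_le hM hf
  rw [formIntegral, norm_div]
  have : ‖(4 : ℂ)‖ = 4 := by norm_num
  rw [this, div_le_iff₀ (by norm_num)]
  have h3 : M * ‖A Set.univ‖ * (‖x‖ ^ 2 + ‖y‖ ^ 2) * 4 =
      M * ‖A Set.univ‖ * ‖x + y‖ ^ 2 + M * ‖A Set.univ‖ * ‖x - y‖ ^ 2 +
      M * ‖A Set.univ‖ * ‖x + Complex.I • y‖ ^ 2 + M * ‖A Set.univ‖ * ‖x - Complex.I • y‖ ^ 2 := by
    linear_combination (-(M * ‖A Set.univ‖)) * (h1 + h2)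
  rw [h3]
  refine (norm_sub_le _ _).trans (add_le_add ((norm_add_le _ _).trans
    (add_le_add ((norm_sub_le _ _).trans (add_le_add (b _) (b _))) ?_)) ?_)
  · rw [norm_mul, Complex.norm_I, one_mul]; exact b _
  · rw [norm_mul, Complex.norm_I, one_mul]; exact b _

/-- On an indicator the form integral is the polarization identity for the operator `A Δ`. -/
lemma isIntegral_indicator (A : POVM X H) {Δ : Set X} (hΔ : MeasurableSet Δ) :
    A.IsIntegral (Δ.indicator 1) (A Δ) := by
  intro x y
  have h : ∀ z : H, ∫ t, Δ.indicator (1 : X → ℂ) t ∂(A.diagMeasure z) = ⟪z, A Δ z⟫_ℂ := by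
    intro z
    rw [integral_indicator hΔ]
    simp only [Pi.one_apply, integral_const, Complex.real_smul, mul_one]
    rw [measureReal_restrict_apply MeasurableSet.univ, Set.univ_inter,
      A.coe_diagMeasure_real_apply z hΔ]
  simp only [formIntegral, h, map_add, map_sub, map_smul, inner_add_left, inner_add_right,
    inner_sub_left, inner_sub_right, inner_smul_left, inner_smul_right, Complex.conj_I]
  linear_combination (-(⟪x, A Δ y⟫_ℂ - ⟪y, A Δ x⟫_ℂ) / 2) * Complex.I_sq

lemma IsIntegral.add {A : POVM X H} {f g : X → ℂ} {S T : H →L[ℂ] H} (hf : A.IsIntegral f S)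
    (hg : A.IsIntegral g T) (bf : BddMeasurable f) (bg : BddMeasurable g) :
    A.IsIntegral (f + g) (S + T) := fun x y => by
  rw [A.formIntegral_add bf bg, ← hf, ← hg, add_apply, inner_add_right]

lemma IsIntegral.smul {A : POVM X H} {f : X → ℂ} {T : H →L[ℂ] H} (hf : A.IsIntegral f T) (c : ℂ) :
    A.IsIntegral (c • f) (c • T) := fun x y => by
  rw [A.formIntegral_smul, ← hf, smul_apply, inner_smul_right]

lemma IsIntegral.sub {A : POVM X H} {f g : X → ℂ} {S T : H →L[ℂ] H} (hf : A.IsIntegral f S)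
    (hg : A.IsIntegral g T) (bf : BddMeasurable f) (bg : BddMeasurable g) :
    A.IsIntegral (f - g) (S - T) := by
  simpa [sub_eq_add_neg] using hf.add (hg.smul (-1)) bf (bg.smul (-1))

lemma isIntegral_zero (A : POVM X H) : A.IsIntegral 0 0 := fun x y => by simp [formIntegral]

lemma IsIntegral.unique {A : POVM X H} {f : X → ℂ} {S T : H →L[ℂ] H} (hS : A.IsIntegral f S)
    (hT : A.IsIntegral f T) : S = T := by
  ext x
  exact ext_inner_left ℂ fun y => by rw [hS, hT]

lemma IsIntegral.inner_self {A : POVM X H} {f : X → ℂ} {T : H →L[ℂ] H} (hT : A.IsIntegral f T)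
    (x : H) : ⟪x, T x⟫_ℂ = ∫ t, f t ∂(A.diagMeasure x) := by
  rw [hT, formIntegral_self]

lemma IsIntegral.norm_le {A : POVM X H} {f : X → ℂ} {T : H →L[ℂ] H} (hT : A.IsIntegral f T)
    {M : ℝ} (hM : 0 ≤ M) (hf : ∀ t, ‖f t‖ ≤ M) : ‖T‖ ≤ 2 * M * ‖A Set.univ‖ := by
  refine T.opNorm_le_of_unit_norm (by positivity) fun x hx => ?_
  -- Testing against the unit vector along `T x` makes the form equal to `‖T x‖`; the factor `2` is
  -- `‖x‖² + ‖y‖²` for unit vectors.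
  have h := A.norm_formIntegral_le hM hf x ((‖T x‖⁻¹ : ℂ) • T x)
  rw [← hT] at h
  by_cases h0 : T x = 0
  · rw [h0, norm_zero]; positivity
  have h0' : ‖T x‖ ≠ 0 := norm_ne_zero_iff.2 h0
  have e : ‖((‖T x‖⁻¹ : ℂ) • T x)‖ = 1 := by
    rw [norm_smul, norm_inv, Complex.norm_real, norm_norm, inv_mul_cancel₀ h0']
  rw [e, hx, inner_smul_left, inner_self_eq_norm_sq_to_K] at h
  have e2 : (starRingEnd ℂ) ((‖T x‖ : ℂ)⁻¹) * ((‖T x‖ : ℂ) ^ 2) = ‖T x‖ := by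
    have : (‖T x‖ : ℂ) ≠ 0 := by exact_mod_cast h0'
    simp only [map_inv₀, Complex.conj_ofReal]
    field_simp
  simp only [Complex.coe_algebraMap] at h
  rw [e2, Complex.norm_real, norm_norm] at h
  linarith

lemma IsIntegral.nonneg {A : POVM X H} {f : X → ℝ} {T : H →L[ℂ] H}
    (hT : A.IsIntegral (fun t => (f t : ℂ)) T) (hf : ∀ t, 0 ≤ f t) : 0 ≤ T := by
  rw [ContinuousLinearMap.nonneg_iff_isPositive, ContinuousLinearMap.isPositive_iff_complex]
  intro x
  have h : ⟪x, T x⟫_ℂ = ((∫ t, f t ∂(A.diagMeasure x) : ℝ) : ℂ) := by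
    rw [hT.inner_self]; exact integral_ofReal
  have h' : ⟪T x, x⟫_ℂ = ((∫ t, f t ∂(A.diagMeasure x) : ℝ) : ℂ) := by
    rw [← inner_conj_symm, h, Complex.conj_ofReal]
  rw [h']
  exact ⟨by simp, by simpa using integral_nonneg hf⟩

end Diag

section Complete

variable {X : Type u} [MeasurableSpace X]
  {H : Type v} [NormedAddCommGroup H] [InnerProductSpace ℂ H] [CompleteSpace H]

/-- Exchanging `x` and `y` multiplies the polarization vectors by unimodular scalars, which leaves
the diagonal measures unchanged but interchanges the two terms with coefficients `±i`; conjugation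
compensates for that. -/
lemma IsIntegral.star {A : POVM X H} {f : X → ℂ} {T : H →L[ℂ] H} (hT : A.IsIntegral f T) :
    A.IsIntegral (fun t => star (f t)) (star T) := by
  intro x y
  rw [ContinuousLinearMap.star_eq_adjoint, ContinuousLinearMap.adjoint_inner_right,
    ← inner_conj_symm, hT]
  have e1 : ∫ t, f t ∂(A.diagMeasure (y - x)) = ∫ t, f t ∂(A.diagMeasure (x - y)) := by
    rw [← neg_sub x y, ← neg_one_smul ℂ, integral_diagMeasure_smul]; simp
  have e2 : ∫ t, f t ∂(A.diagMeasure (y + Complex.I • x)) =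
      ∫ t, f t ∂(A.diagMeasure (x - Complex.I • y)) := by
    have : y + Complex.I • x = Complex.I • (x - Complex.I • y) := by
      rw [smul_sub, smul_smul, Complex.I_mul_I, neg_one_smul]; abel
    rw [this, integral_diagMeasure_smul]; simp
  have e3 : ∫ t, f t ∂(A.diagMeasure (y - Complex.I • x)) =
      ∫ t, f t ∂(A.diagMeasure (x + Complex.I • y)) := by
    have : y - Complex.I • x = (-Complex.I) • (x + Complex.I • y) := by
      rw [smul_add, smul_smul, neg_mul, Complex.I_mul_I, neg_neg, one_smul, neg_smul]; abel
    rw [this, integral_diagMeasure_smul]; simp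
  have c : ∀ z, ∫ t, Star.star (f t) ∂(A.diagMeasure z) =
      (starRingEnd ℂ) (∫ t, f t ∂(A.diagMeasure z)) := fun z => integral_conj
  simp only [formIntegral, e1, e2, e3, c, add_comm y x, map_div₀, map_add, map_sub, map_mul,
    Complex.conj_I]
  have : (starRingEnd ℂ) 4 = 4 := Complex.conj_ofNat 4
  rw [this]
  ring

lemma IsIntegral.le {A : POVM X H} {f g : X → ℝ} {S T : H →L[ℂ] H}
    (hS : A.IsIntegral (fun t => (f t : ℂ)) S) (hT : A.IsIntegral (fun t => (g t : ℂ)) T)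
    (bf : BddMeasurable fun t => (f t : ℂ)) (bg : BddMeasurable fun t => (g t : ℂ))
    (h : ∀ t, f t ≤ g t) : S ≤ T := by
  rw [← sub_nonneg]
  refine IsIntegral.nonneg (A := A) (f := fun t => g t - f t) ?_ fun t => sub_nonneg.2 (h t)
  convert hT.sub hS bg bf using 1
  ext t
  simp

/-- A uniform limit of functions having integrals in a closed set has its integral in that set. -/
lemma exists_isIntegral_of_approx (A : POVM X H) {K : Set (H →L[ℂ] H)} (hK : IsClosed K)
    {f : X → ℂ} (bf : BddMeasurable f)
    (h : ∀ ε > 0, ∃ φ, BddMeasurable φ ∧ (∀ t, ‖f t - φ t‖ ≤ ε) ∧ ∃ T ∈ K, A.IsIntegral φ T) :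
    ∃ T ∈ K, A.IsIntegral f T := by
  have hpos : ∀ n : ℕ, (0 : ℝ) < 1 / (n + 1) := fun n => Nat.one_div_pos_of_nat
  choose φ bφ hφ T hTK hT using fun n : ℕ => h (1 / ((n : ℝ) + 1)) (hpos n)
  have hC : CauchySeq T := by
    -- Two approximants within `1/(N+1)` of `f` differ by at most twice that; the other `2` comes
    -- from `IsIntegral.norm_le`.
    refine cauchySeq_of_le_tendsto_0 (fun n : ℕ => 2 * (2 * (1 / ((n : ℝ) + 1))) * ‖A Set.univ‖)
      (fun n m N hn hm => ?_) ?_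
    · rw [dist_eq_norm]
      refine ((hT n).sub (hT m) (bφ n) (bφ m)).norm_le (by have := hpos N; positivity) fun t => ?_
      have e : (φ n - φ m) t = (f t - φ m t) - (f t - φ n t) := by simp
      rw [e]
      refine (norm_sub_le _ _).trans ?_
      have h1 := (hφ m t).trans (Nat.one_div_le_one_div hm)
      have h2 := (hφ n t).trans (Nat.one_div_le_one_div hn)
      linarith
    · have := tendsto_one_div_add_atTop_nhds_zero_nat (𝕜 := ℝ)
      simpa using ((this.const_mul 2).const_mul 2).mul_const ‖A Set.univ‖
  obtain ⟨S, hS⟩ := cauchySeq_tendsto_of_complete hC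
  refine ⟨S, hK.mem_of_tendsto hS (Eventually.of_forall hTK), fun x y => ?_⟩
  have l1 : Tendsto (fun n => ⟪y, T n x⟫_ℂ) atTop (𝓝 ⟪y, S x⟫_ℂ) :=
    tendsto_const_nhds.inner ((ContinuousLinearMap.apply ℂ H x).continuous.tendsto S |>.comp hS)
  refine tendsto_nhds_unique l1 ?_
  rw [tendsto_iff_norm_sub_tendsto_zero]
  have l2 : Tendsto (fun n : ℕ => 1 / ((n : ℝ) + 1) * ‖A Set.univ‖ * (‖x‖ ^ 2 + ‖y‖ ^ 2)) atTop
      (𝓝 0) := by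
    simpa using ((tendsto_one_div_add_atTop_nhds_zero_nat (𝕜 := ℝ)).mul_const
      ‖A Set.univ‖).mul_const (‖x‖ ^ 2 + ‖y‖ ^ 2)
  refine squeeze_zero (fun _ => norm_nonneg _) (fun n => ?_) l2
  have e : ⟪y, T n x⟫_ℂ - A.formIntegral f x y = A.formIntegral (φ n - f) x y := by
    rw [hT n]
    have := A.formIntegral_add (bφ n |>.sub bf) bf x y
    rw [sub_add_cancel] at this
    rw [this, add_sub_cancel_right]
  rw [e]
  refine A.norm_formIntegral_le (hpos n).le (fun t => ?_) x y
  rw [Pi.sub_apply, norm_sub_rev]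
  exact hφ n t

end Complete

end POVM

/-! ### The limit `ħ → 0` and the topology of `[0, 1]` at `0` -/

namespace Planck

lemma toZero_hasBasis : toZero.HasBasis (fun _ : Planck => True) Set.Iic := by
  refine ⟨fun s => ?_⟩
  rw [toZero, (Metric.nhds_basis_ball.comap _).mem_iff]
  constructor
  · rintro ⟨ε, hε, h⟩
    have hm : 0 < min (ε / 2) 1 := lt_min (half_pos hε) one_pos
    refine ⟨⟨min (ε / 2) 1, hm, min_le_right _ _⟩, trivial, fun ħ hħ => h ?_⟩
    have h1 : (ħ : ℝ) ≤ min (ε / 2) 1 := hħ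
    have h2 := h1.trans (min_le_left _ _)
    rw [Set.mem_preimage, Metric.mem_ball, Real.dist_eq, sub_zero, abs_of_pos ħ.2.1]
    linarith
  · rintro ⟨δ, -, h⟩
    refine ⟨δ, δ.2.1, fun ħ hħ => h ?_⟩
    rw [Set.mem_preimage, Metric.mem_ball, Real.dist_eq, sub_zero, abs_of_pos ħ.2.1] at hħ
    exact hħ.le

instance : toZero.NeBot :=
  toZero_hasBasis.neBot_iff.2 fun {δ} _ => ⟨δ, Set.self_mem_Iic⟩

lemma eventually_toZero {p : Planck → Prop} :
    (∀ᶠ ħ in toZero, p ħ) ↔ ∃ δ : Planck, ∀ ħ ≤ δ, p ħ := by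
  rw [toZero_hasBasis.eventually_iff]
  simp

lemma toI_ne_zero (ħ : Planck) : ħ.toI ≠ 0 := fun h => ħ.2.1.ne' (congrArg Subtype.val h)

lemma eq_zero_or_exists_toI (t : unitInterval) : t = 0 ∨ ∃ ħ : Planck, ħ.toI = t := by
  by_cases h : t = 0
  · exact Or.inl h
  · exact Or.inr ⟨⟨t, lt_of_le_of_ne t.2.1 fun e => h (Subtype.ext e.symm), t.2.2⟩, rfl⟩

lemma isOpenEmbedding_toI : IsOpenEmbedding toI := by
  have hr : Set.range toI = {0}ᶜ := by
    ext t
    constructor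
    · rintro ⟨ħ, rfl⟩
      exact toI_ne_zero ħ
    · intro ht
      exact (eq_zero_or_exists_toI t).resolve_left ht
  refine ⟨⟨?_, ?_⟩, ?_⟩
  · rw [← IsInducing.subtypeVal.of_comp_iff (f := toI) (g := (Subtype.val : unitInterval → ℝ))]
    exact IsInducing.subtypeVal
  · intro a b h
    exact Subtype.ext (congrArg (fun t : unitInterval => (t : ℝ)) h)
  · rw [hr]
    exact isOpen_compl_singleton

lemma map_toI_nhds (ħ : Planck) : map toI (𝓝 ħ) = 𝓝 ħ.toI := isOpenEmbedding_toI.map_nhds_eq ħ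

/-- Splits every local condition at `0` into one on the fiber at `0` and one along `ħ → 0`. -/
lemma nhds_zero_eq : 𝓝 (0 : unitInterval) = pure 0 ⊔ map toI toZero := by
  ext s
  rw [mem_sup, mem_pure, mem_map, toZero_hasBasis.mem_iff, Metric.mem_nhds_iff]
  constructor
  · rintro ⟨ε, hε, h⟩
    refine ⟨h (Metric.mem_ball_self hε), ?_⟩
    have hm : 0 < min (ε / 2) 1 := lt_min (half_pos hε) one_pos
    refine ⟨⟨min (ε / 2) 1, hm, min_le_right _ _⟩, trivial, fun ħ hħ => h ?_⟩
    have h1 : (ħ : ℝ) ≤ min (ε / 2) 1 := hħ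
    have h2 := h1.trans (min_le_left _ _)
    have h3 : dist ħ.toI 0 = |(ħ : ℝ) - 0| := rfl
    rw [Metric.mem_ball, h3, sub_zero, abs_of_pos ħ.2.1]
    linarith
  · rintro ⟨h0, δ, -, h⟩
    refine ⟨δ, δ.2.1, fun t ht => ?_⟩
    obtain rfl | ⟨ħ, rfl⟩ := eq_zero_or_exists_toI t
    · exact h0
    · refine h ?_
      have h3 : dist ħ.toI 0 = |(ħ : ℝ) - 0| := rfl
      rw [Metric.mem_ball, h3, sub_zero, abs_of_pos ħ.2.1] at ht
      exact ht.le

lemma eventually_nhds_zero {p : unitInterval → Prop} :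
    (∀ᶠ t in 𝓝 0, p t) ↔ p 0 ∧ ∀ᶠ ħ in toZero, p (toI ħ) := by
  rw [nhds_zero_eq, eventually_sup, eventually_pure, eventually_map]

lemma tendsto_coe_toZero : Tendsto (fun ħ : Planck => (ħ : ℝ)) toZero (𝓝 0) := tendsto_comap

lemma continuous_unitInterval {E : Type*} [TopologicalSpace E] {f : unitInterval → E}
    (h : Continuous fun ħ : Planck => f ħ.toI)
    (h0 : Tendsto (fun ħ : Planck => f ħ.toI) toZero (𝓝 (f 0))) : Continuous f := by
  rw [continuous_iff_continuousAt]
  intro t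
  obtain rfl | ⟨ħ, rfl⟩ := eq_zero_or_exists_toI t
  · rw [ContinuousAt, nhds_zero_eq, tendsto_sup, tendsto_map'_iff]
    exact ⟨tendsto_pure_nhds f 0, h0⟩
  · rw [ContinuousAt, ← map_toI_nhds, tendsto_map'_iff]
    exact h.tendsto ħ

end Planck

/-! ### Gluing a continuous field from an asymptotic family -/

section GluedField

variable {𝒜 : Type u} {B : Type v} [NonUnitalCStarAlgebra 𝒜] [NonUnitalCStarAlgebra B]

variable (𝒜 B) in
/-- The fiber at `t` of the field glued from `𝒜` at `0` and `B` on `(0, 1]`, realized inside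
`𝒜 × B`. -/
def gluedFiber (t : unitInterval) : NonUnitalStarSubalgebra ℂ (𝒜 × B) where
  carrier := {p | (t ≠ 0 → p.1 = 0) ∧ (t = 0 → p.2 = 0)}
  add_mem' ha hb := ⟨fun h => by simp [ha.1 h, hb.1 h], fun h => by simp [ha.2 h, hb.2 h]⟩
  zero_mem' := by simp
  mul_mem' ha hb := ⟨fun h => by simp [ha.1 h], fun h => by simp [ha.2 h]⟩
  smul_mem' c _ ha := ⟨fun h => by simp [ha.1 h], fun h => by simp [ha.2 h]⟩
  star_mem' ha := ⟨fun h => by simp [ha.1 h], fun h => by simp [ha.2 h]⟩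

/-- Closedness lets every fiber inherit its C⋆-structure from `𝒜 × B`, with no case distinction on
`t` at the level of types. -/
instance (t : unitInterval) : IsClosed (gluedFiber 𝒜 B t : Set (𝒜 × B)) := by
  have : (gluedFiber 𝒜 B t : Set (𝒜 × B)) =
      {p | t ≠ 0 → p.1 = 0} ∩ {p | t = 0 → p.2 = 0} := rfl
  rw [this]
  refine IsClosed.inter ?_ ?_
  · by_cases h : t = 0
    · simp [h]
    · simpa [h] using isClosed_eq continuous_fst continuous_const
  · by_cases h : t = 0
    · simpa [h] using isClosed_eq continuous_snd continuous_const
    · simp [h]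

namespace gluedFiber

lemma fst_eq_zero {ħ : Planck} (p : gluedFiber 𝒜 B ħ.toI) : p.1.1 = 0 := p.2.1 ħ.toI_ne_zero

lemma snd_eq_zero (p : gluedFiber 𝒜 B 0) : p.1.2 = 0 := p.2.2 rfl

lemma norm_toI {ħ : Planck} (p : gluedFiber 𝒜 B ħ.toI) : ‖p‖ = ‖p.1.2‖ := by
  change ‖p.1‖ = _
  rw [Prod.norm_def, fst_eq_zero, norm_zero, max_eq_right (norm_nonneg _)]

lemma norm_zero_fiber (p : gluedFiber 𝒜 B 0) : ‖p‖ = ‖p.1.1‖ := by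
  change ‖p.1‖ = _
  rw [Prod.norm_def, snd_eq_zero, norm_zero, max_eq_left (norm_nonneg _)]

variable (𝒜 B) in
/-- The fiber at `0` is `𝒜`. -/
def zeroIso : gluedFiber 𝒜 B 0 ≃⋆ₐ[ℂ] 𝒜 where
  toFun p := p.1.1
  invFun a := ⟨(a, 0), fun h => (h rfl).elim, fun _ => rfl⟩
  left_inv p := Subtype.ext (Prod.ext rfl (snd_eq_zero p).symm)
  right_inv _ := rfl
  map_add' _ _ := rfl
  map_mul' _ _ := rfl
  map_star' _ := rfl
  map_smul' _ _ := rfl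

variable (𝒜 B) in
/-- The fibers over `(0, 1]` are `B`. -/
def posIso (ħ : Planck) : gluedFiber 𝒜 B ħ.toI ≃⋆ₐ[ℂ] B where
  toFun p := p.1.2
  invFun b := ⟨(0, b), fun _ => rfl, fun h => (ħ.toI_ne_zero h).elim⟩
  left_inv p := Subtype.ext (Prod.ext (fst_eq_zero p).symm rfl)
  right_inv _ := rfl
  map_add' _ _ := rfl
  map_mul' _ _ := rfl
  map_star' _ := rfl
  map_smul' _ _ := rfl

open Classical in
/-- The vector field with value `a` at `0` and `g ħ` at `ħ ∈ (0, 1]`. -/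
noncomputable def mkField (a : 𝒜) (g : unitInterval → B) (t : unitInterval) : gluedFiber 𝒜 B t :=
  ⟨(if t = 0 then a else 0, if t = 0 then 0 else g t), fun h => if_neg h, fun h => if_pos h⟩

lemma mkField_zero (a : 𝒜) (g : unitInterval → B) : (mkField a g 0).1.1 = a := if_pos rfl

lemma mkField_toI (a : 𝒜) (g : unitInterval → B) (ħ : Planck) :
    (mkField a g ħ.toI).1.2 = g ħ.toI := if_neg ħ.toI_ne_zero

end gluedFiber

/-- The properties of a family of linear maps `𝒜 → B` that make it define a continuous field
over `[0, 1]`. -/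
structure IsGluingFamily (Q : Planck → 𝒜 →ₗ[ℂ] B) : Prop where
  star : ∀ ħ a, Q ħ (star a) = star (Q ħ a)
  bound : ∃ C : ℝ, ∀ᶠ ħ in Planck.toZero, ∀ a, ‖Q ħ a‖ ≤ C * ‖a‖
  continuousOn : ∃ ħ₀, ∀ a, ContinuousOn (fun ħ => Q ħ a) (Set.Iic ħ₀)
  mul : ∀ a b, Tendsto (fun ħ => ‖Q ħ (a * b) - Q ħ a * Q ħ b‖) Planck.toZero (𝓝 0)
  norm : ∀ a, Tendsto (fun ħ => ‖Q ħ a‖) Planck.toZero (𝓝 ‖a‖)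

/-- If `b ħ - Q ħ a → 0`, then `‖b ħ‖ → ‖a‖`. -/
lemma IsGluingFamily.tendsto_norm {Q : Planck → 𝒜 →ₗ[ℂ] B} (hQ : IsGluingFamily Q) {a : 𝒜}
    {b : Planck → B} (h : Tendsto (fun ħ => ‖b ħ - Q ħ a‖) Planck.toZero (𝓝 0)) :
    Tendsto (fun ħ => ‖b ħ‖) Planck.toZero (𝓝 ‖a‖) := by
  have h1 : Tendsto (fun ħ => ‖b ħ‖ - ‖Q ħ a‖) Planck.toZero (𝓝 0) :=
    squeeze_zero_norm (fun ħ => abs_norm_sub_norm_le _ _) h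
  simpa using h1.add (hQ.norm a)

/-- The continuous sections of the field glued along `Q`. -/
def gluedSections (Q : Planck → 𝒜 →ₗ[ℂ] B) (hQ : IsGluingFamily Q) :
    NonUnitalStarSubalgebra ℂ (∀ t, gluedFiber 𝒜 B t) where
  carrier := {s | (Continuous fun ħ : Planck => (s ħ.toI).1.2) ∧
    Tendsto (fun ħ : Planck => ‖(s ħ.toI).1.2 - Q ħ (s 0).1.1‖) Planck.toZero (𝓝 0)}
  add_mem' {s r} hs hr := by
    refine ⟨hs.1.add hr.1, squeeze_zero (fun _ => norm_nonneg _) (fun ħ => ?_)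
      (by simpa using hs.2.add hr.2)⟩
    have e : ((s + r) ħ.toI).1.2 - Q ħ ((s + r) 0).1.1 =
        ((s ħ.toI).1.2 - Q ħ (s 0).1.1) + ((r ħ.toI).1.2 - Q ħ (r 0).1.1) := by
      change (s ħ.toI).1.2 + (r ħ.toI).1.2 - Q ħ ((s 0).1.1 + (r 0).1.1) = _
      rw [map_add]; abel
    rw [e]
    exact norm_add_le _ _
  zero_mem' := by
    have e : ∀ ħ : Planck, ((0 : ∀ t, gluedFiber 𝒜 B t) ħ.toI).1.2 = 0 := fun _ => rfl
    have e0 : ((0 : ∀ t, gluedFiber 𝒜 B t) 0).1.1 = 0 := rfl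
    refine ⟨continuous_const, ?_⟩
    simp only [e, e0, map_zero, sub_zero, norm_zero]
    exact tendsto_const_nhds
  mul_mem' {s r} hs hr := by
    refine ⟨hs.1.mul hr.1, ?_⟩
    -- The defect of a product splits into the defect of `s` times `r`, `Q ħ a` times the defect of
    -- `r`, and the multiplicative defect of `Q`. The undisturbed factors have convergent norms, so
    -- every term vanishes in the limit.
    have l := ((hs.2.mul (hQ.tendsto_norm hr.2)).add ((hQ.norm (s 0).1.1).mul hr.2)).add
      (hQ.mul (s 0).1.1 (r 0).1.1)
    simp only [zero_mul, mul_zero, add_zero] at l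
    refine squeeze_zero (fun _ => norm_nonneg _) (fun ħ => ?_) l
    have e : ((s * r) ħ.toI).1.2 - Q ħ ((s * r) 0).1.1 =
        ((s ħ.toI).1.2 - Q ħ (s 0).1.1) * (r ħ.toI).1.2 +
          Q ħ (s 0).1.1 * ((r ħ.toI).1.2 - Q ħ (r 0).1.1) -
          (Q ħ ((s 0).1.1 * (r 0).1.1) - Q ħ (s 0).1.1 * Q ħ (r 0).1.1) := by
      change (s ħ.toI).1.2 * (r ħ.toI).1.2 - Q ħ ((s 0).1.1 * (r 0).1.1) = _
      noncomm_ring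
    rw [e]
    exact (norm_sub_le _ _).trans (add_le_add_left ((norm_add_le _ _).trans
      (add_le_add (norm_mul_le _ _) (norm_mul_le _ _))) _)
  smul_mem' c s hs := by
    refine ⟨hs.1.const_smul c, squeeze_zero (fun _ => norm_nonneg _) (fun ħ => ?_)
      (by simpa using hs.2.const_mul ‖c‖)⟩
    have e : ((c • s) ħ.toI).1.2 - Q ħ ((c • s) 0).1.1 =
        c • ((s ħ.toI).1.2 - Q ħ (s 0).1.1) := by
      change c • (s ħ.toI).1.2 - Q ħ (c • (s 0).1.1) = _
      rw [map_smul, smul_sub]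
    rw [e, norm_smul]
  star_mem' {s} hs := by
    refine ⟨hs.1.star, hs.2.congr fun ħ => ?_⟩
    change _ = ‖star (s ħ.toI).1.2 - Q ħ (star (s 0).1.1)‖
    rw [hQ.star, ← star_sub, norm_star]

lemma mem_gluedSections {Q : Planck → 𝒜 →ₗ[ℂ] B} {hQ : IsGluingFamily Q}
    {s : ∀ t, gluedFiber 𝒜 B t} : s ∈ gluedSections Q hQ ↔
      (Continuous fun ħ : Planck => (s ħ.toI).1.2) ∧
      Tendsto (fun ħ : Planck => ‖(s ħ.toI).1.2 - Q ħ (s 0).1.1‖) Planck.toZero (𝓝 0) := Iff.rfl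

/-- Through every point over `0` there passes a continuous section. -/
lemma exists_gluedSection_zero {Q : Planck → 𝒜 →ₗ[ℂ] B} (hQ : IsGluingFamily Q) (a : 𝒜) :
    ∃ s ∈ gluedSections Q hQ, (s 0).1.1 = a := by
  obtain ⟨ħ₀, h₀⟩ := hQ.continuousOn
  -- Continuity of `Q` is known only up to `ħ₀`, so the section is frozen beyond it; only its
  -- behaviour near `0` is prescribed.
  let g : Planck → B := fun ħ => Q (min ħ ħ₀) a
  have hg : Continuous g := (h₀ a).comp_continuous (continuous_id.min continuous_const)
    fun ħ => Set.mem_Iic.2 (min_le_right _ _)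
  let s := gluedFiber.mkField a (Function.extend Planck.toI g 0)
  have e : ∀ ħ : Planck, (s ħ.toI).1.2 = g ħ := fun ħ => by
    rw [gluedFiber.mkField_toI, Planck.isOpenEmbedding_toI.injective.extend_apply]
  have e0 : (s 0).1.1 = a := gluedFiber.mkField_zero _ _
  refine ⟨s, mem_gluedSections.2 ⟨by simpa only [e] using hg, ?_⟩, e0⟩
  simp only [e, e0]
  refine tendsto_const_nhds.congr' (Planck.eventually_toZero.2 ⟨ħ₀, fun ħ h => ?_⟩)
  simp only [g]
  rw [min_eq_left h, sub_self, norm_zero]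

/-- The continuous section `ħ ↦ (ħ / ħ₁) b`. -/
lemma exists_gluedSection_toI {Q : Planck → 𝒜 →ₗ[ℂ] B} (hQ : IsGluingFamily Q) (ħ₁ : Planck)
    (b : B) : ∃ s ∈ gluedSections Q hQ, (s 0).1.1 = 0 ∧
      ∀ ħ : Planck, (s ħ.toI).1.2 = (((ħ : ℝ) / (ħ₁ : ℝ) : ℝ) : ℂ) • b := by
  -- The scalar factor is `1` at `ħ₁` and tends to `0`, so any `b` is attained at `ħ₁` by a section
  -- vanishing at `0`.
  let s := gluedFiber.mkField (0 : 𝒜) fun t => (((t : ℝ) / (ħ₁ : ℝ) : ℝ) : ℂ) • b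
  have e : ∀ ħ : Planck, (s ħ.toI).1.2 = (((ħ : ℝ) / (ħ₁ : ℝ) : ℝ) : ℂ) • b := fun ħ =>
    gluedFiber.mkField_toI _ _ ħ
  have e0 : (s 0).1.1 = 0 := gluedFiber.mkField_zero _ _
  refine ⟨s, mem_gluedSections.2 ⟨?_, ?_⟩, e0, e⟩
  · simp only [e]
    fun_prop
  · simp only [e, e0, map_zero, sub_zero]
    have h1 : Tendsto (fun ħ : Planck => (((ħ : ℝ) / (ħ₁ : ℝ) : ℝ) : ℂ) • b) Planck.toZero
        (𝓝 (((0 / (ħ₁ : ℝ) : ℝ) : ℂ) • b)) :=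
      ((Complex.continuous_ofReal.tendsto _).comp
        (Planck.tendsto_coe_toZero.div_const _)).smul_const b
    simpa using h1.norm

lemma continuousWithinAt_of_locally_approx {S E : Type*} [TopologicalSpace S]
    [SeminormedAddCommGroup E] {x : S → E} {D : Set S} {s : S} (hs : s ∈ D)
    (h : ∀ ε > 0, ∃ y : S → E, ContinuousWithinAt y D s ∧ ∀ᶠ s' in 𝓝[D] s, ‖x s' - y s'‖ ≤ ε) :
    ContinuousWithinAt x D s := by
  rw [ContinuousWithinAt, Metric.tendsto_nhds]
  intro ε hε
  obtain ⟨y, hy, hxy⟩ := h (ε / 4) (by positivity)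
  have h1 := hxy.self_of_nhdsWithin hs
  filter_upwards [hxy, Metric.tendsto_nhds.1 hy (ε / 4) (by positivity)] with s' h2 h3
  rw [← dist_eq_norm] at h1 h2
  rw [dist_comm] at h1
  have := dist_triangle4 (x s') (y s') (y s) (x s)
  linarith

lemma continuous_of_locally_approx {S E : Type*} [TopologicalSpace S] [SeminormedAddCommGroup E]
    {x : S → E} (h : ∀ s, ∀ ε > 0, ∃ y : S → E, Continuous y ∧ ∀ᶠ s' in 𝓝 s, ‖x s' - y s'‖ ≤ ε) :
    Continuous x := by
  rw [continuous_iff_continuousAt]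
  intro s
  rw [← continuousWithinAt_univ]
  refine continuousWithinAt_of_locally_approx (Set.mem_univ s) fun ε hε => ?_
  obtain ⟨y, hy, hxy⟩ := h s ε hε
  exact ⟨y, hy.continuousWithinAt, by rwa [nhdsWithin_univ]⟩

/-- The continuous field glued along `Q`. -/
def gluedField (Q : Planck → 𝒜 →ₗ[ℂ] B) (hQ : IsGluingFamily Q) :
    ContinuousField unitInterval fun t => gluedFiber 𝒜 B t where
  sections := gluedSections Q hQ
  dense_values t := by
    obtain rfl | ⟨ħ, rfl⟩ := Planck.eq_zero_or_exists_toI t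
    · convert dense_univ
      refine Set.eq_univ_of_forall fun a => ?_
      obtain ⟨s, hs, h⟩ := exists_gluedSection_zero hQ a.1.1
      exact ⟨s, hs, (gluedFiber.zeroIso 𝒜 B).injective h⟩
    · convert dense_univ
      refine Set.eq_univ_of_forall fun b => ?_
      obtain ⟨s, hs, -, h⟩ := exists_gluedSection_toI hQ ħ b.1.2
      refine ⟨s, hs, (gluedFiber.posIso 𝒜 B ħ).injective ((h ħ).trans ?_)⟩
      rw [div_self ħ.2.1.ne', Complex.ofReal_one, one_smul]
      rfl
  continuous_norm s hs := by
    refine Planck.continuous_unitInterval ?_ ?_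
    · simp only [gluedFiber.norm_toI]
      exact hs.1.norm
    · simp only [gluedFiber.norm_toI]
      rw [gluedFiber.norm_zero_fiber]
      exact hQ.tendsto_norm hs.2
  mem_of_locally_approx x hx := by
    refine mem_gluedSections.2 ⟨continuous_of_locally_approx fun ħ ε hε => ?_, ?_⟩
    · obtain ⟨s, hs, h⟩ := hx ħ.toI ε hε
      rw [← Planck.map_toI_nhds, eventually_map] at h
      refine ⟨_, hs.1, h.mono fun ħ' h' => ?_⟩
      rwa [gluedFiber.norm_toI] at h'
    · obtain ⟨C, hC⟩ := hQ.bound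
      rw [Metric.tendsto_nhds]
      intro ε hε
      have hD : 0 < 3 * (|C| + 1) := by positivity
      -- The approximation error enters twice: directly over `ħ`, and through `Q ħ` at `0` with
      -- factor at most `|C|`. Together these cost `ε / 3`, and the defect of `s` costs another `ε /
      -- 3`.
      obtain ⟨s, hs, h⟩ := hx 0 (ε / (3 * (|C| + 1))) (by positivity)
      obtain ⟨h0, h⟩ := Planck.eventually_nhds_zero.1 h
      rw [gluedFiber.norm_zero_fiber] at h0
      filter_upwards [h, hC, Metric.tendsto_nhds.1 hs.2 (ε / 3) (by positivity)] with ħ h1 h2 h3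
      rw [gluedFiber.norm_toI] at h1
      have h1 : ‖(x ħ.toI).1.2 - (s ħ.toI).1.2‖ ≤ ε / (3 * (|C| + 1)) := h1
      have h0 : ‖(x 0).1.1 - (s 0).1.1‖ ≤ ε / (3 * (|C| + 1)) := h0
      rw [Real.dist_eq, sub_zero, abs_norm] at h3 ⊢
      have e : (x ħ.toI).1.2 - Q ħ (x 0).1.1 = ((x ħ.toI).1.2 - (s ħ.toI).1.2) +
          ((s ħ.toI).1.2 - Q ħ (s 0).1.1) - Q ħ ((x 0).1.1 - (s 0).1.1) := by
        rw [map_sub]; abel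
      have h4 : ‖Q ħ ((x 0).1.1 - (s 0).1.1)‖ ≤ |C| * (ε / (3 * (|C| + 1))) :=
        (h2 _).trans (mul_le_mul (le_abs_self C) h0 (norm_nonneg _) (abs_nonneg C))
      have h5 : ε / (3 * (|C| + 1)) + |C| * (ε / (3 * (|C| + 1))) = ε / 3 := by
        field_simp; ring
      rw [e]
      have := norm_sub_le (((x ħ.toI).1.2 - (s ħ.toI).1.2) + ((s ħ.toI).1.2 - Q ħ (s 0).1.1))
        (Q ħ ((x 0).1.1 - (s 0).1.1))
      have := norm_add_le ((x ħ.toI).1.2 - (s ħ.toI).1.2) ((s ħ.toI).1.2 - Q ħ (s 0).1.1)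
      linarith

end GluedField

/-- The strong deformation glued along `Q`. -/
noncomputable def gluedDeformation {X : Type u} [TopologicalSpace X] {B : Type v}
    [NonUnitalCStarAlgebra B] (Q : Planck → C₀(X, ℂ) →ₗ[ℂ] B) (hQ : IsGluingFamily Q) :
    StrongDeformation X B where
  fiber t := gluedFiber C₀(X, ℂ) B t
  field := gluedField Q hQ
  zeroIso := gluedFiber.zeroIso C₀(X, ℂ) B
  posIso := gluedFiber.posIso C₀(X, ℂ) B
  trivial_on_pos x := by
    constructor
    · intro h
      refine continuous_of_locally_approx fun ħ ε hε => ?_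
      obtain ⟨s, hs, h'⟩ := h ħ ε hε
      refine ⟨_, hs.1, h'.mono fun ħ' h'' => ?_⟩
      rwa [gluedFiber.norm_toI] at h''
    · intro h ħ ε hε
      -- A section agreeing with `x` at the single point `ħ` suffices: by continuity the difference
      -- stays below `ε` nearby.
      obtain ⟨s, hs, -, hs'⟩ := exists_gluedSection_toI hQ ħ (x ħ).1.2
      refine ⟨s, hs, ?_⟩
      have h1 : Continuous fun ħ' : Planck => ‖(x ħ').1.2 - (s ħ'.toI).1.2‖ := (h.sub hs.1).norm
      have h2 : ‖(x ħ).1.2 - (s ħ.toI).1.2‖ < ε := by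
        rw [hs', div_self ħ.2.1.ne', Complex.ofReal_one, one_smul, sub_self, norm_zero]
        exact hε
      filter_upwards [(h1.tendsto ħ).eventually_lt_const h2] with ħ' h3
      rw [gluedFiber.norm_toI]
      exact h3.le

lemma gluedDeformation_isAssociated {X : Type u} [TopologicalSpace X] {B : Type v}
    [NonUnitalCStarAlgebra B] (Q : Planck → C₀(X, ℂ) →ₗ[ℂ] B) (hQ : IsGluingFamily Q) :
    (gluedDeformation Q hQ).IsAssociated Q := fun _ => Iff.rfl

/-! ### Uniform approximation in `C₀(X)` by indicators of pre-compact open sets -/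

section PrecompactSimple

variable {X : Type u} [TopologicalSpace X]

variable (X) in
/-- The linear combinations of indicators of pre-compact open sets. -/
def precompactSimple : Submodule ℂ (X → ℂ) :=
  Submodule.span ℂ ((fun U : Set X => U.indicator 1) '' precompactOpens X)

lemma indicator_mem_precompactSimple {U : Set X} (hU : U ∈ precompactOpens X) :
    U.indicator 1 ∈ precompactSimple X :=
  Submodule.subset_span ⟨U, hU, rfl⟩

/-- Uniform approximability by linear combinations of indicators of pre-compact open sets. -/
def IsPrecompactApprox (f : X → ℂ) : Prop :=
  ∀ ε > 0, ∃ φ ∈ precompactSimple X, ∀ t, ‖f t - φ t‖ ≤ ε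

lemma IsPrecompactApprox.add {f g : X → ℂ} (hf : IsPrecompactApprox f)
    (hg : IsPrecompactApprox g) : IsPrecompactApprox (f + g) := by
  intro ε hε
  obtain ⟨φ, hφ, h1⟩ := hf (ε / 2) (half_pos hε)
  obtain ⟨ψ, hψ, h2⟩ := hg (ε / 2) (half_pos hε)
  refine ⟨φ + ψ, add_mem hφ hψ, fun t => ?_⟩
  rw [Pi.add_apply, Pi.add_apply, add_sub_add_comm]
  refine (norm_add_le _ _).trans ?_
  linarith [h1 t, h2 t]

lemma IsPrecompactApprox.smul {f : X → ℂ} (hf : IsPrecompactApprox f) (c : ℂ) :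
    IsPrecompactApprox (c • f) := by
  intro ε hε
  obtain ⟨φ, hφ, h1⟩ := hf (ε / (‖c‖ + 1)) (by positivity)
  refine ⟨c • φ, Submodule.smul_mem _ c hφ, fun t => ?_⟩
  rw [Pi.smul_apply, Pi.smul_apply, ← smul_sub, norm_smul]
  calc ‖c‖ * ‖f t - φ t‖ ≤ (‖c‖ + 1) * (ε / (‖c‖ + 1)) := by
        gcongr
        · linarith
        · exact h1 t
    _ = ε := by field_simp

lemma abs_sub_layer_sum_le {r ε : ℝ} (hε : 0 < ε) (hr : 0 ≤ r) {N : ℕ} (hN : r ≤ N * ε) :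
    |r - ∑ k ∈ Finset.range N, if (k + 1) * ε < r then ε else 0| ≤ ε := by
  -- Invariant of the layer sum: either all `n` layers lie below `r` and are counted, or `r` has
  -- been passed and the sum falls short of it by at most `ε`.
  have key : ∀ n : ℕ,
      (n * ε < r ∧ (∑ k ∈ Finset.range n, if (k + 1) * ε < r then ε else 0) = n * ε) ∨
      (r ≤ n * ε ∧ (∑ k ∈ Finset.range n, if (k + 1) * ε < r then ε else 0) ≤ r ∧
        r ≤ (∑ k ∈ Finset.range n, if (k + 1) * ε < r then ε else 0) + ε) := by
    intro n
    induction n with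
    | zero =>
      rcases hr.lt_or_eq with h | h
      · exact Or.inl (by simpa using h)
      · exact Or.inr (by simp [← h, hε.le])
    | succ n ih =>
      rw [Finset.sum_range_succ]
      push_cast
      rcases ih with ⟨h1, h2⟩ | ⟨h1, h2, h3⟩
      · by_cases h : (n + 1) * ε < r
        · exact Or.inl ⟨h, by rw [if_pos h, h2]; ring⟩
        · rw [if_neg h, h2, add_zero]
          exact Or.inr ⟨not_lt.1 h, h1.le, by linarith [not_lt.1 h]⟩
      · have h : ¬ (n + 1) * ε < r := by rw [not_lt]; linarith
        rw [if_neg h, add_zero]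
        exact Or.inr ⟨not_lt.1 h, h2, h3⟩
  rw [abs_le]
  rcases key N with ⟨h1, h2⟩ | ⟨h1, h2, h3⟩
  · linarith
  · constructor <;> linarith

lemma ZeroAtInftyContinuousMap.norm_apply_le (f : C₀(X, ℂ)) (t : X) : ‖f t‖ ≤ ‖f‖ :=
  f.toBCF.norm_coe_le_norm t

lemma ZeroAtInftyContinuousMap.exists_lt_norm {f : C₀(X, ℂ)} {r : ℝ} (hr : 0 ≤ r) (h : r < ‖f‖) :
    ∃ t, r < ‖f t‖ := by
  by_contra! hc
  exact absurd ((BoundedContinuousFunction.norm_le (f := f.toBCF) hr).2 hc) (not_le.2 h)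

lemma ZeroAtInftyContinuousMap.coe_star_mul_self (f : C₀(X, ℂ)) :
    ⇑(star f * f) = fun t => ((‖f t‖ ^ 2 : ℝ) : ℂ) := by
  ext t
  rw [ZeroAtInftyContinuousMap.mul_apply, ZeroAtInftyContinuousMap.star_apply]
  exact_mod_cast RCLike.conj_mul (f t)

/-- The closure lies in `{s ≤ ‖f‖}`, which sits inside a compact set since `f` vanishes at infinity.
Separate `h`, `r`, `s` cover both parts of `f` and `‖f‖²`. -/
lemma ZeroAtInftyContinuousMap.setOf_lt_mem_precompactOpens (f : C₀(X, ℂ)) {h : X → ℝ}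
    (hc : Continuous h) {r s : ℝ} (hs : 0 < s) (hf : ∀ t, r ≤ h t → s ≤ ‖f t‖) :
    {t | r < h t} ∈ precompactOpens X := by
  refine ⟨isOpen_lt continuous_const hc, ?_⟩
  have h1 : {t | s ≤ ‖f t‖}ᶜ ∈ cocompact X := by
    have := f.zero_at_infty'.norm
    rw [norm_zero] at this
    filter_upwards [this.eventually_lt_const hs] with t ht
    simpa using ht
  obtain ⟨K, hK, hK'⟩ := mem_cocompact.1 h1
  refine hK.of_isClosed_subset isClosed_closure ?_
  refine (closure_minimal (fun t ht => ?_) (isClosed_le continuous_const f.continuous.norm)).trans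
    (Set.compl_subset_compl.1 hK')
  exact hf t (le_of_lt ht)

lemma ZeroAtInftyContinuousMap.isPrecompactApprox_of_nonneg (f : C₀(X, ℂ)) {h : X → ℝ}
    (hc : Continuous h) (h0 : ∀ t, 0 ≤ h t) (hf : ∀ t, h t ≤ ‖f t‖) :
    IsPrecompactApprox fun t => (h t : ℂ) := by
  intro ε hε
  -- `N` layers of height `ε` reach the maximum of `‖f‖`; counting them from height `ε` rather than
  -- `0` keeps their supports pre-compact.
  obtain ⟨N, hN⟩ := exists_nat_ge (‖f‖ / ε)
  refine ⟨∑ k ∈ Finset.range N, (ε : ℂ) • {t | ((k : ℝ) + 1) * ε < h t}.indicator 1,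
    Submodule.sum_mem _ fun k _ => Submodule.smul_mem _ _ (indicator_mem_precompactSimple
      (f.setOf_lt_mem_precompactOpens hc (s := (k + 1) * ε) (by positivity)
        fun t ht => ht.trans (hf t))), fun t => ?_⟩
  have hb : h t ≤ N * ε := (hf t).trans ((f.norm_apply_le t).trans ((div_le_iff₀ hε).1 hN))
  have e : (∑ k ∈ Finset.range N, (ε : ℂ) • {t | ((k : ℝ) + 1) * ε < h t}.indicator
      (1 : X → ℂ)) t = ((∑ k ∈ Finset.range N, if (k + 1) * ε < h t then ε else 0 : ℝ) : ℂ) := by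
    rw [Finset.sum_apply, Complex.ofReal_sum]
    refine Finset.sum_congr rfl fun k _ => ?_
    by_cases hk : ((k : ℝ) + 1) * ε < h t <;> simp [hk]
  rw [e, ← Complex.ofReal_sub, Complex.norm_real]
  exact abs_sub_layer_sum_le hε (h0 t) hb

lemma ZeroAtInftyContinuousMap.isPrecompactApprox (f : C₀(X, ℂ)) : IsPrecompactApprox f := by
  have hre : Continuous fun t => (f t).re := Complex.continuous_re.comp f.continuous
  have him : Continuous fun t => (f t).im := Complex.continuous_im.comp f.continuous
  have a1 := f.isPrecompactApprox_of_nonneg (hre.max continuous_const) (fun t => le_max_right _ 0)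
    fun t => max_le ((le_abs_self _).trans (Complex.abs_re_le_norm _)) (norm_nonneg _)
  have a2 := f.isPrecompactApprox_of_nonneg ((continuous_neg.comp hre).max continuous_const)
    (fun t => le_max_right _ 0)
    fun t => max_le ((neg_le_abs _).trans (Complex.abs_re_le_norm _)) (norm_nonneg _)
  have a3 := f.isPrecompactApprox_of_nonneg (him.max continuous_const) (fun t => le_max_right _ 0)
    fun t => max_le ((le_abs_self _).trans (Complex.abs_im_le_norm _)) (norm_nonneg _)
  have a4 := f.isPrecompactApprox_of_nonneg ((continuous_neg.comp him).max continuous_const)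
    (fun t => le_max_right _ 0)
    fun t => max_le ((neg_le_abs _).trans (Complex.abs_im_le_norm _)) (norm_nonneg _)
  convert ((a1.add (a2.smul (-1))).add (a3.smul Complex.I)).add (a4.smul (-Complex.I)) using 1
  ext t
  have key : ∀ r : ℝ, r = max r 0 - max (-r) 0 := fun r => by
    rcases le_total 0 r with h | h
    · rw [max_eq_left h, max_eq_right (by linarith)]; ring
    · rw [max_eq_right h, max_eq_left (by linarith)]; ring
  simp only [Pi.add_apply, Pi.smul_apply, smul_eq_mul, Function.comp_apply]
  conv_lhs => rw [← Complex.re_add_im (f t), key (f t).re, key (f t).im]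
  push_cast
  ring

variable [MeasurableSpace X] [BorelSpace X]

lemma BddMeasurable.of_mem_precompactSimple {φ : X → ℂ} (hφ : φ ∈ precompactSimple X) :
    BddMeasurable φ := by
  induction hφ using Submodule.span_induction with
  | mem φ hφ =>
    obtain ⟨U, hU, rfl⟩ := hφ
    exact BddMeasurable.indicator hU.1.measurableSet
  | zero => exact ⟨measurable_zero, 0, fun t => by simp⟩
  | add φ ψ _ _ h1 h2 => exact h1.add h2
  | smul c φ _ h => exact h.smul c

lemma ZeroAtInftyContinuousMap.bddMeasurable (f : C₀(X, ℂ)) : BddMeasurable f :=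
  ⟨f.continuous.measurable, ‖f‖, f.norm_apply_le⟩

end PrecompactSimple

/-! ### Mass bounds, multiplicative defects and norms of asymptotic projections -/

section MeasurableQuantization

variable {X : Type u} [MeasurableSpace X]
  {H : Type v} [NormedAddCommGroup H] [InnerProductSpace ℂ H]

/-- Since the `limsup` is taken in `[0, ∞]`, a strict bound on it yields an eventual bound with no
side condition. -/
lemma IsASM.eventually_norm_lt {ℰ : Set (Set X)} {A : Planck → POVM X H}
    (hA : IsASM ℰ A) {c : ℝ} (hc : 1 < c) :
    ∀ᶠ ħ in Planck.toZero, ‖A ħ Set.univ‖ < c := by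
  have h1 : limsup (fun ħ => ‖A ħ Set.univ‖ₑ) Planck.toZero < ENNReal.ofReal c :=
    hA.limsup_le.trans_lt (by simpa using hc)
  filter_upwards [eventually_lt_of_limsup_lt h1] with ħ h
  rw [← ofReal_norm, ENNReal.ofReal_lt_ofReal_iff (by linarith)] at h
  exact h

/-- The multiplicative defect of a POVM depends continuously on the functions. -/
lemma POVM.norm_defect_sub_le {A : POVM X H} (hA : ‖A Set.univ‖ ≤ 2) {f g φ ψ : X → ℂ}
    {S T R S' T' R' : H →L[ℂ] H} (hS : A.IsIntegral f S) (hT : A.IsIntegral g T)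
    (hR : A.IsIntegral (f * g) R) (hS' : A.IsIntegral φ S') (hT' : A.IsIntegral ψ T')
    (hR' : A.IsIntegral (φ * ψ) R') (bf : BddMeasurable f) (bg : BddMeasurable g)
    (bφ : BddMeasurable φ) (bψ : BddMeasurable ψ) {F G δ : ℝ} (hF0 : 0 ≤ F) (hG0 : 0 ≤ G)
    (hδ : 0 ≤ δ) (hδ1 : δ ≤ 1)
    (hF : ∀ t, ‖f t‖ ≤ F) (hG : ∀ t, ‖g t‖ ≤ G) (hfφ : ∀ t, ‖f t - φ t‖ ≤ δ)
    (hgψ : ∀ t, ‖g t - ψ t‖ ≤ δ) :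
    ‖(R - S * T) - (R' - S' * T')‖ ≤ 20 * (F + G + 1) * δ := by
  have hφ : ∀ t, ‖φ t‖ ≤ F + 1 := fun t => by
    have e : φ t = f t - (f t - φ t) := by ring
    rw [e]
    exact (norm_sub_le _ _).trans (add_le_add (hF t) ((hfφ t).trans hδ1))
  -- The constant `4` is the `2` of `IsIntegral.norm_le` times the mass bound `2`; the final `20` is
  -- `4 + 16`.
  have bound : ∀ {k : X → ℂ} {K : H →L[ℂ] H} {M : ℝ}, 0 ≤ M → A.IsIntegral k K →
      (∀ t, ‖k t‖ ≤ M) → ‖K‖ ≤ 4 * M := fun {k K M} hM hK hk => by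
    have := hK.norm_le hM hk
    nlinarith
  have h1 : ‖R - R'‖ ≤ 4 * ((F + G + 1) * δ) := by
    refine bound (by positivity) (hR.sub hR' (bf.mul bg) (bφ.mul bψ)) fun t => ?_
    have e : (f * g - φ * ψ) t = (f t - φ t) * g t + φ t * (g t - ψ t) := by
      simp only [Pi.sub_apply, Pi.mul_apply]; ring
    rw [e]
    calc _ ≤ ‖f t - φ t‖ * ‖g t‖ + ‖φ t‖ * ‖g t - ψ t‖ := by
          rw [← norm_mul, ← norm_mul]; exact norm_add_le _ _
      _ ≤ δ * G + (F + 1) * δ := by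
          gcongr
          exacts [hfφ t, hG t, hφ t, hgψ t]
      _ = _ := by ring
  have h2 : ‖S - S'‖ ≤ 4 * δ := bound hδ (hS.sub hS' bf bφ) hfφ
  have h3 : ‖T - T'‖ ≤ 4 * δ := bound hδ (hT.sub hT' bg bψ) hgψ
  have h4 : ‖T‖ ≤ 4 * G := bound hG0 hT hG
  have h5 : ‖S'‖ ≤ 4 * (F + 1) := bound (by positivity) hS' hφ
  have e : (R - S * T) - (R' - S' * T') = (R - R') - ((S - S') * T + S' * (T - T')) := by
    noncomm_ring
  rw [e]
  calc _ ≤ ‖R - R'‖ + (‖S - S'‖ * ‖T‖ + ‖S'‖ * ‖T - T'‖) :=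
        (norm_sub_le _ _).trans (add_le_add_right ((norm_add_le _ _).trans
          (add_le_add (norm_mul_le _ _) (norm_mul_le _ _))) _)
    _ ≤ 4 * ((F + G + 1) * δ) + (4 * δ * (4 * G) + 4 * (F + 1) * (4 * δ)) := by gcongr
    _ = _ := by ring

/-- The values of an injective asymptotic spectral measure have asymptotic norm `1`. -/
lemma IsASM.tendsto_norm_one [CompleteSpace H] {ℰ : Set (Set X)} {A : Planck → POVM X H}
    (hA : IsASM ℰ A) (hinj : IsInjectiveASM ℰ A) {U : Set X} (hU : U ∈ ℰ) (hm : MeasurableSet U)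
    (hne : U.Nonempty) :
    Tendsto (fun ħ => ‖A ħ U‖) Planck.toZero (𝓝 1) := by
  obtain ⟨c, hc0, hc⟩ := ENNReal.lt_iff_exists_nnreal_btwn.1 (hinj U hU hne)
  have hc0 : (0 : ℝ) < c := by exact_mod_cast hc0
  have hp := hA.proj U hU U hU
  simp only [Set.inter_self] at hp
  rw [tendsto_iff_norm_sub_tendsto_zero]
  have hp' := hp.div_const (c : ℝ)
  rw [zero_div] at hp'
  refine squeeze_zero' (Eventually.of_forall fun _ => norm_nonneg _) ?_ hp'
  filter_upwards [eventually_lt_of_lt_liminf hc] with ħ h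
  have hc' : (c : ℝ) < ‖A ħ U‖ := by
    rw [← ofReal_norm, ← ENNReal.ofReal_coe_nnreal] at h
    exact (ENNReal.ofReal_lt_ofReal_iff_of_nonneg c.2).1 h
  have hsa : star (A ħ U) = A ħ U := (IsSelfAdjoint.of_nonneg ((A ħ).nonneg' U hm)).star_eq
  have hsq : ‖A ħ U * A ħ U‖ = ‖A ħ U‖ * ‖A ħ U‖ := by
    rw [← CStarRing.norm_star_mul_self, hsa]
  rw [le_div_iff₀ hc0]
  -- With `a = ‖A ħ U‖ > c`, this is `|a - 1| c ≤ |a - a²| ≤ ‖A ħ U - (A ħ U)²‖`; injectivity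
  -- supplies `c > 0`, ruling out the limit `0`.
  calc ‖‖A ħ U‖ - 1‖ * c ≤ ‖‖A ħ U‖ - 1‖ * ‖A ħ U‖ := by gcongr
    _ = |‖A ħ U‖ - ‖A ħ U * A ħ U‖| := by
        rw [hsq, Real.norm_eq_abs]
        nth_rw 2 [← abs_of_nonneg (norm_nonneg (A ħ U))]
        rw [← abs_mul, ← abs_neg]
        congr 1
        ring
    _ ≤ _ := abs_norm_sub_norm_le _ _

end MeasurableQuantization

/-! ### Asymptotics of the integrals of `C₀` functions -/

section Quantization

variable {X : Type u} [TopologicalSpace X] [MeasurableSpace X] [BorelSpace X]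
  {H : Type v} [NormedAddCommGroup H] [InnerProductSpace ℂ H]
  {A : Planck → POVM X H}

/-- Linear combinations of indicators of pre-compact open sets have continuous families of
integrals. -/
lemma IsASM.exists_integral_precompactSimple (hA : IsASM (precompactOpens X) A) {φ : X → ℂ}
    (hφ : φ ∈ precompactSimple X) :
    ∃ T : Planck → H →L[ℂ] H, Continuous T ∧ ∀ ħ, (A ħ).IsIntegral φ (T ħ) := by
  induction hφ using Submodule.span_induction with
  | mem φ hφ =>
    obtain ⟨U, hU, rfl⟩ := hφ
    exact ⟨_, hA.continuous U hU, fun ħ => (A ħ).isIntegral_indicator hU.1.measurableSet⟩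
  | zero => exact ⟨fun _ => 0, continuous_const, fun ħ => (A ħ).isIntegral_zero⟩
  | add φ ψ hφ hψ h1 h2 =>
    obtain ⟨S, hS, hS'⟩ := h1
    obtain ⟨T, hT, hT'⟩ := h2
    exact ⟨_, hS.add hT, fun ħ => (hS' ħ).add (hT' ħ) (.of_mem_precompactSimple hφ)
      (.of_mem_precompactSimple hψ)⟩
  | smul c φ _ h =>
    obtain ⟨T, hT, hT'⟩ := h
    exact ⟨_, hT.const_smul c, fun ħ => (hT' ħ).smul c⟩

/-- Asymptotic multiplicativity on linear combinations of indicators of pre-compact open sets. -/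
lemma IsASM.exists_integral_mul_precompactSimple (hA : IsASM (precompactOpens X) A) {φ ψ : X → ℂ}
    (hφ : φ ∈ precompactSimple X) (hψ : ψ ∈ precompactSimple X) :
    ∃ S T R : Planck → H →L[ℂ] H, (∀ ħ, (A ħ).IsIntegral φ (S ħ)) ∧
      (∀ ħ, (A ħ).IsIntegral ψ (T ħ)) ∧ (∀ ħ, (A ħ).IsIntegral (φ * ψ) (R ħ)) ∧
      Tendsto (fun ħ => R ħ - S ħ * T ħ) Planck.toZero (𝓝 0) := by
  induction hφ, hψ using Submodule.span_induction₂ with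
  | mem_mem φ ψ hφ hψ =>
    obtain ⟨U, hU, rfl⟩ := hφ
    obtain ⟨V, hV, rfl⟩ := hψ
    refine ⟨fun ħ => A ħ U, fun ħ => A ħ V, fun ħ => A ħ (U ∩ V),
      fun ħ => (A ħ).isIntegral_indicator hU.1.measurableSet,
      fun ħ => (A ħ).isIntegral_indicator hV.1.measurableSet, fun ħ => ?_,
      tendsto_zero_iff_norm_tendsto_zero.2 (hA.proj U hU V hV)⟩
    have e : (U.indicator 1 * V.indicator 1 : X → ℂ) = (U ∩ V).indicator 1 :=
      Set.inter_indicator_one.symm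
    simp only [e]
    exact (A ħ).isIntegral_indicator (hU.1.inter hV.1).measurableSet
  | zero_left ψ hψ =>
    obtain ⟨T, -, hT⟩ := hA.exists_integral_precompactSimple hψ
    exact ⟨fun _ => 0, T, fun _ => 0, fun ħ => (A ħ).isIntegral_zero, hT,
      fun ħ => by rw [zero_mul]; exact (A ħ).isIntegral_zero, by simp⟩
  | zero_right φ hφ =>
    obtain ⟨T, -, hT⟩ := hA.exists_integral_precompactSimple hφ
    exact ⟨T, fun _ => 0, fun _ => 0, hT, fun ħ => (A ħ).isIntegral_zero,
      fun ħ => by rw [mul_zero]; exact (A ħ).isIntegral_zero, by simp⟩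
  | add_left φ φ' ψ hφ hφ' hψ h h' =>
    obtain ⟨S, T, R, hS, hT, hR, hl⟩ := h
    obtain ⟨S', T', R', hS', hT', hR', hl'⟩ := h'
    have bφ := BddMeasurable.of_mem_precompactSimple hφ
    have bφ' := BddMeasurable.of_mem_precompactSimple hφ'
    have bψ := BddMeasurable.of_mem_precompactSimple hψ
    -- Uniqueness of integrals identifies the operators that the two induction hypotheses supply for
    -- `ψ`.
    obtain rfl : T' = T := funext fun ħ => (hT' ħ).unique (hT ħ)
    refine ⟨S + S', T', R + R', fun ħ => (hS ħ).add (hS' ħ) bφ bφ', hT, fun ħ => ?_, ?_⟩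
    · rw [add_mul]
      exact (hR ħ).add (hR' ħ) (bφ.mul bψ) (bφ'.mul bψ)
    · have := hl.add hl'
      rw [add_zero] at this
      refine this.congr fun ħ => ?_
      simp only [Pi.add_apply]
      noncomm_ring
  | add_right φ ψ ψ' hφ hψ hψ' h h' =>
    obtain ⟨S, T, R, hS, hT, hR, hl⟩ := h
    obtain ⟨S', T', R', hS', hT', hR', hl'⟩ := h'
    have bφ := BddMeasurable.of_mem_precompactSimple hφ
    have bψ := BddMeasurable.of_mem_precompactSimple hψ
    have bψ' := BddMeasurable.of_mem_precompactSimple hψ'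
    obtain rfl : S' = S := funext fun ħ => (hS' ħ).unique (hS ħ)
    refine ⟨S', T + T', R + R', hS, fun ħ => (hT ħ).add (hT' ħ) bψ bψ', fun ħ => ?_, ?_⟩
    · rw [mul_add]
      exact (hR ħ).add (hR' ħ) (bφ.mul bψ) (bφ.mul bψ')
    · have := hl.add hl'
      rw [add_zero] at this
      refine this.congr fun ħ => ?_
      simp only [Pi.add_apply]
      noncomm_ring
  | smul_left c φ ψ _ _ h =>
    obtain ⟨S, T, R, hS, hT, hR, hl⟩ := h
    refine ⟨c • S, T, c • R, fun ħ => (hS ħ).smul c, hT, fun ħ => ?_, ?_⟩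
    · rw [smul_mul_assoc]
      exact (hR ħ).smul c
    · have := hl.const_smul c
      rw [smul_zero] at this
      refine this.congr fun ħ => ?_
      simp only [Pi.smul_apply, smul_sub, smul_mul_assoc]
  | smul_right c φ ψ _ _ h =>
    obtain ⟨S, T, R, hS, hT, hR, hl⟩ := h
    refine ⟨S, c • T, c • R, hS, fun ħ => (hT ħ).smul c, fun ħ => ?_, ?_⟩
    · rw [mul_smul_comm]
      exact (hR ħ).smul c
    · have := hl.const_smul c
      rw [smul_zero] at this
      refine this.congr fun ħ => ?_
      simp only [Pi.smul_apply, smul_sub, mul_smul_comm]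

/-- Asymptotic multiplicativity of the integrals of functions vanishing at infinity. -/
lemma IsASM.tendsto_defect (hA : IsASM (precompactOpens X) A) {f g : C₀(X, ℂ)}
    {S T R : Planck → H →L[ℂ] H} (hS : ∀ ħ, (A ħ).IsIntegral f (S ħ))
    (hT : ∀ ħ, (A ħ).IsIntegral g (T ħ)) (hR : ∀ ħ, (A ħ).IsIntegral (f * g : C₀(X, ℂ)) (R ħ)) :
    Tendsto (fun ħ => R ħ - S ħ * T ħ) Planck.toZero (𝓝 0) := by
  rw [Metric.tendsto_nhds]
  intro ε hε
  have hK : 0 < 20 * (‖f‖ + ‖g‖ + 1) := by positivity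
  -- The defect changes by at most `20 (‖f‖ + ‖g‖ + 1) δ ≤ ε / 2`; the cap `1` keeps the
  -- approximants bounded by `‖f‖ + 1` and `‖g‖ + 1`.
  have hδ : 0 < min 1 (ε / 2 / (20 * (‖f‖ + ‖g‖ + 1))) := by positivity
  obtain ⟨φ, hφ, hfφ⟩ := f.isPrecompactApprox _ hδ
  obtain ⟨ψ, hψ, hgψ⟩ := g.isPrecompactApprox _ hδ
  obtain ⟨S', T', R', hS', hT', hR', hl⟩ := hA.exists_integral_mul_precompactSimple hφ hψ
  filter_upwards [hA.eventually_norm_lt one_lt_two,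
    Metric.tendsto_nhds.1 hl (ε / 2) (half_pos hε)] with ħ h1 h2
  rw [dist_zero_right] at h2 ⊢
  have h3 := POVM.norm_defect_sub_le h1.le (hS ħ) (hT ħ) (hR ħ) (hS' ħ) (hT' ħ) (hR' ħ)
    f.bddMeasurable g.bddMeasurable (.of_mem_precompactSimple hφ) (.of_mem_precompactSimple hψ)
    (norm_nonneg f) (norm_nonneg g) hδ.le (min_le_left _ _) f.norm_apply_le g.norm_apply_le
    hfφ hgψ
  have h4 : 20 * (‖f‖ + ‖g‖ + 1) * min 1 (ε / 2 / (20 * (‖f‖ + ‖g‖ + 1))) ≤ ε / 2 := by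
    rw [← le_div_iff₀' hK]
    exact min_le_right _ _
  have h5 := norm_add_le ((R ħ - S ħ * T ħ) - (R' ħ - S' ħ * T' ħ)) (R' ħ - S' ħ * T' ħ)
  rw [sub_add_cancel] at h5
  linarith

/-- The integrals of a function vanishing at infinity depend continuously on `ħ` where the total
masses are locally bounded. -/
lemma IsASM.continuousOn_integral (hA : IsASM (precompactOpens X) A) {f : C₀(X, ℂ)}
    {T : Planck → H →L[ℂ] H} (hT : ∀ ħ, (A ħ).IsIntegral f (T ħ)) {D : Set Planck}
    (hD : ∀ ħ ∈ D, ∃ C : ℝ, ∀ᶠ ħ' in 𝓝[D] ħ, ‖A ħ' Set.univ‖ ≤ C) : ContinuousOn T D := by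
  intro ħ hħ
  refine continuousWithinAt_of_locally_approx hħ fun ε hε => ?_
  obtain ⟨C, hC⟩ := hD ħ hħ
  have hδ : 0 < ε / (2 * (|C| + 1)) := by positivity
  obtain ⟨φ, hφ, hfφ⟩ := f.isPrecompactApprox _ hδ
  obtain ⟨T', hT'c, hT'⟩ := hA.exists_integral_precompactSimple hφ
  refine ⟨T', hT'c.continuousWithinAt, hC.mono fun ħ' h => ?_⟩
  refine (((hT ħ').sub (hT' ħ') f.bddMeasurable (.of_mem_precompactSimple hφ)).norm_le hδ.le
    hfφ).trans ?_
  calc 2 * (ε / (2 * (|C| + 1))) * ‖A ħ' Set.univ‖ ≤ 2 * (ε / (2 * (|C| + 1))) * (|C| + 1) := by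
        gcongr
        linarith [le_abs_self C]
    _ = ε := by field_simp

variable [CompleteSpace H]

/-- The norms of the integrals of `|f|²` tend to `‖f‖²`. -/
lemma IsASM.tendsto_norm_integral_sq (hA : IsASM (precompactOpens X) A)
    (hinj : IsInjectiveASM (precompactOpens X) A) {f : C₀(X, ℂ)} {R : Planck → H →L[ℂ] H}
    (hR : ∀ ħ, (A ħ).IsIntegral (star f * f : C₀(X, ℂ)) (R ħ)) :
    Tendsto (fun ħ => ‖R ħ‖) Planck.toZero (𝓝 (‖f‖ ^ 2)) := by
  have e := f.coe_star_mul_self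
  have hR' : ∀ ħ, (A ħ).IsIntegral (fun t => ((‖f t‖ ^ 2 : ℝ) : ℂ)) (R ħ) := fun ħ => e ▸ hR ħ
  have bR : BddMeasurable fun t => ((‖f t‖ ^ 2 : ℝ) : ℂ) := e ▸ (star f * f).bddMeasurable
  have ind : ∀ (ħ : Planck) (r : ℝ) {U : Set X}, MeasurableSet U →
      (A ħ).IsIntegral (fun t => ((U.indicator (fun _ => r) t : ℝ) : ℂ)) ((r : ℂ) • A ħ U) ∧
      BddMeasurable fun t => ((U.indicator (fun _ => r) t : ℝ) : ℂ) := fun ħ r U hU => by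
    have : (fun t => ((U.indicator (fun _ => r) t : ℝ) : ℂ)) =
        (r : ℂ) • U.indicator (1 : X → ℂ) := by
      ext t
      by_cases h : t ∈ U <;> simp [h]
    rw [this]
    exact ⟨((A ħ).isIntegral_indicator hU).smul _, (BddMeasurable.indicator hU).smul _⟩
  rw [tendsto_order]
  constructor
  · intro a ha
    by_cases ha0 : a < 0
    · exact Eventually.of_forall fun ħ => ha0.trans_le (norm_nonneg _)
    rw [not_lt] at ha0
    -- Lower bound: with `U = {|f|² > r}`, `r A(U) ≤ R`, and `‖A(U)‖ → 1` eventually exceeds `a / r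
    -- < 1`.
    obtain ⟨r, har, hr⟩ := exists_between ha
    have hr0 : 0 < r := ha0.trans_lt har
    have hU : {t | r < ‖f t‖ ^ 2} ∈ precompactOpens X :=
      f.setOf_lt_mem_precompactOpens (s := √r) (by fun_prop) (Real.sqrt_pos.2 hr0)
        fun t ht => Real.sqrt_le_iff.2 ⟨norm_nonneg _, ht⟩
    have hne : {t | r < ‖f t‖ ^ 2}.Nonempty := by
      obtain ⟨t, ht⟩ := ZeroAtInftyContinuousMap.exists_lt_norm (f := f) (Real.sqrt_nonneg r)
        ((Real.sqrt_lt' (by by_contra! h; nlinarith [norm_nonneg f, h.antisymm (norm_nonneg f)])).2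
          hr)
      exact ⟨t, (Real.sqrt_lt_sqrt_iff hr0.le).1 (by rwa [Real.sqrt_sq (norm_nonneg _)])⟩
    have hmU := hU.1.measurableSet
    filter_upwards [(hA.tendsto_norm_one hinj hU hmU hne).eventually_const_lt
      ((div_lt_one hr0).2 har)] with ħ h
    have i := ind ħ r hmU
    have hnn : 0 ≤ (r : ℂ) • A ħ {t | r < ‖f t‖ ^ 2} := i.1.nonneg fun t =>
      Set.indicator_nonneg (fun _ _ => hr0.le) t
    have hle : (r : ℂ) • A ħ {t | r < ‖f t‖ ^ 2} ≤ R ħ := by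
      refine i.1.le (hR' ħ) i.2 bR fun t => ?_
      by_cases ht : r < ‖f t‖ ^ 2
      · rw [Set.indicator_of_mem (by exact ht)]
        exact ht.le
      · rw [Set.indicator_of_notMem (by exact ht)]
        positivity
    have := CStarAlgebra.norm_le_norm_of_nonneg_of_le hnn hle
    rw [norm_smul, Complex.norm_real, Real.norm_of_nonneg hr0.le] at this
    rw [div_lt_iff₀' hr0] at h
    exact h.trans_le this
  · intro a ha
    -- Comparing positive operators, `R ≤ ‖f‖² A(X)`, avoids the factor `2` of `IsIntegral.norm_le`,
    -- which would spoil the sharp limit.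
    have hup : ∀ ħ, ‖R ħ‖ ≤ ‖f‖ ^ 2 * ‖A ħ Set.univ‖ := fun ħ => by
      have i := ind ħ (‖f‖ ^ 2) MeasurableSet.univ
      have := CStarAlgebra.norm_le_norm_of_nonneg_of_le ((hR' ħ).nonneg fun t => by positivity)
        ((hR' ħ).le i.1 bR i.2 fun t => by
          rw [Set.indicator_univ]
          gcongr
          exact f.norm_apply_le t)
      rwa [norm_smul, Complex.norm_real, Real.norm_of_nonneg (by positivity)] at this
    obtain ⟨c, hc, hca⟩ : ∃ c > 1, ‖f‖ ^ 2 * c < a := by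
      have hlim : Tendsto (fun c : ℝ => ‖f‖ ^ 2 * c) (𝓝[>] 1) (𝓝 (‖f‖ ^ 2 * 1)) :=
        (tendsto_id.mono_left nhdsWithin_le_nhds).const_mul _
      rw [mul_one] at hlim
      have hgt : ∀ᶠ c : ℝ in 𝓝[>] 1, c ∈ Set.Ioi 1 := self_mem_nhdsWithin
      exact (hgt.and (hlim.eventually_lt_const ha)).exists
    filter_upwards [hA.eventually_norm_lt hc] with ħ h
    exact (hup ħ).trans_lt ((mul_le_mul_of_nonneg_left h.le (by positivity)).trans_lt hca)

/-- The norms of the integrals of `f` tend to `‖f‖`. -/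
lemma IsASM.tendsto_norm_integral (hA : IsASM (precompactOpens X) A)
    (hinj : IsInjectiveASM (precompactOpens X) A) {f : C₀(X, ℂ)} {T R : Planck → H →L[ℂ] H}
    (hT : ∀ ħ, (A ħ).IsIntegral f (T ħ))
    (hR : ∀ ħ, (A ħ).IsIntegral (star f * f : C₀(X, ℂ)) (R ħ)) :
    Tendsto (fun ħ => ‖T ħ‖) Planck.toZero (𝓝 ‖f‖) := by
  have h1 := hA.tendsto_norm_integral_sq hinj hR
  -- `‖T‖² = ‖T⋆ T‖` differs from `‖R‖` by a null term.
  have h2 := hA.tendsto_defect (f := star f) (fun ħ => (hT ħ).star) hT hR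
  have h3 : Tendsto (fun ħ => ‖R ħ‖ - ‖star (T ħ) * T ħ‖) Planck.toZero (𝓝 0) :=
    squeeze_zero_norm (fun ħ => abs_norm_sub_norm_le _ _) (tendsto_zero_iff_norm_tendsto_zero.1 h2)
  have h4 := (h1.sub h3).sqrt
  rw [sub_zero, Real.sqrt_sq (norm_nonneg _)] at h4
  refine h4.congr fun ħ => ?_
  rw [sub_sub_cancel, CStarRing.norm_star_mul_self, Real.sqrt_mul_self (norm_nonneg _)]

/-- Positive operators in a closed `*`-subalgebra have the form `b⋆ b` there. -/
lemma exists_star_mul_self_eq_of_nonneg (B : NonUnitalStarSubalgebra ℂ (H →L[ℂ] H))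
    [hB : IsClosed (B : Set (H →L[ℂ] H))] (a : B) (ha : 0 ≤ (a : H →L[ℂ] H)) :
    ∃ b : B, a = star b * b := by
  -- The square root vanishes at `0`, so the non-unital functional calculus keeps it in the closed
  -- subalgebra.
  have hmem : CFC.sqrt (a : H →L[ℂ] H) ∈ B := by
    rw [CFC.sqrt_eq_real_sqrt _ ha]
    exact cfcₙ_mem (𝕜 := ℝ) (𝕜' := ℂ) _ a.2
  refine ⟨⟨_, hmem⟩, Subtype.ext ?_⟩
  change (a : H →L[ℂ] H) = star (CFC.sqrt (a : H →L[ℂ] H)) * CFC.sqrt (a : H →L[ℂ] H)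
  rw [(IsSelfAdjoint.of_nonneg (CFC.sqrt_nonneg _)).star_eq, CFC.sqrt_mul_sqrt_self _ ha]

lemma IsLocallyValued.exists_integral (B : NonUnitalStarSubalgebra ℂ (H →L[ℂ] H))
    [hB : IsClosed (B : Set (H →L[ℂ] H))] (hAB : IsLocallyValued B A) (ħ : Planck) (f : C₀(X, ℂ)) :
    ∃ T : B, (A ħ).IsIntegral f (T : H →L[ℂ] H) := by
  obtain ⟨T, hTB, hT⟩ := (A ħ).exists_isIntegral_of_approx hB f.bddMeasurable fun ε hε => by
    obtain ⟨φ, hφ, h⟩ := f.isPrecompactApprox ε hε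
    refine ⟨φ, .of_mem_precompactSimple hφ, h, ?_⟩
    clear h
    induction hφ using Submodule.span_induction with
    | mem φ hφ =>
      obtain ⟨U, hU, rfl⟩ := hφ
      exact ⟨_, hAB ħ U hU, (A ħ).isIntegral_indicator hU.1.measurableSet⟩
    | zero => exact ⟨0, zero_mem B, (A ħ).isIntegral_zero⟩
    | add φ ψ hφ hψ h1 h2 =>
      obtain ⟨S, hS, hS'⟩ := h1
      obtain ⟨T, hT, hT'⟩ := h2
      exact ⟨_, add_mem hS hT, hS'.add hT' (.of_mem_precompactSimple hφ)
        (.of_mem_precompactSimple hψ)⟩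
    | smul c φ _ h =>
      obtain ⟨T, hT, hT'⟩ := h
      exact ⟨_, SMulMemClass.smul_mem c hT, hT'.smul c⟩
  exact ⟨⟨T, hTB⟩, hT⟩

/-- Uniqueness of weak integrals makes the chosen operators linear in `f`. -/
lemma IsLocallyValued.exists_linearMap (B : NonUnitalStarSubalgebra ℂ (H →L[ℂ] H))
    [IsClosed (B : Set (H →L[ℂ] H))]
    (hAB : IsLocallyValued B A) : ∃ Q : Planck → C₀(X, ℂ) →ₗ[ℂ] B,
      ∀ ħ (f : C₀(X, ℂ)), (A ħ).IsIntegral f (Q ħ f : H →L[ℂ] H) := by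
  choose T hT using hAB.exists_integral B
  refine ⟨fun ħ => ⟨⟨T ħ, fun f g => Subtype.ext ?_⟩, fun c f => Subtype.ext ?_⟩, hT⟩
  · exact (hT ħ (f + g)).unique ((hT ħ f).add (hT ħ g) f.bddMeasurable g.bddMeasurable)
  · exact (hT ħ (c • f)).unique ((hT ħ f).smul c)

end Quantization

/-! ### Assembly of the theorem -/

theorem theorem5p4p2 {X : Type u} [TopologicalSpace X] [LocallyCompactSpace X] [T2Space X]
    [MeasurableSpace X] [BorelSpace X]
    {H : Type v} [NormedAddCommGroup H] [InnerProductSpace ℂ H] [CompleteSpace H]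
    (B : NonUnitalStarSubalgebra ℂ (H →L[ℂ] H)) [IsClosed (B : Set (H →L[ℂ] H))]
    (hB : IsHereditary B)
    (A : Planck → POVM X H) (hA : IsASM (precompactOpens X) A) (hAB : IsLocallyValued B A)
    (hinj : IsInjectiveASM (precompactOpens X) A) :
    ∃ Q : Planck → C₀(X, ℂ) →ₗ[ℂ] B,
      (∀ ħ (f : C₀(X, ℂ)), (A ħ).IsIntegral f (Q ħ f : H →L[ℂ] H)) ∧
      (∃ ħ₀ : Planck, IsPositiveAsymptoticMorphismOn (Set.Iic ħ₀) Q) ∧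
      ((∀ ħ₀ : Planck, ∃ C : ℝ, ∀ᶠ ħ in 𝓝 ħ₀, ‖A ħ Set.univ‖ ≤ C) →
        IsPositiveAsymptoticMorphism Q) ∧
      IsInjectiveAsymptotic Q ∧
      (∀ f : C₀(X, ℂ), Tendsto (fun ħ => ‖Q ħ f‖) Planck.toZero (𝓝 ‖f‖)) ∧
      ∃ D : StrongDeformation X B, D.IsAssociated Q := by
  obtain ⟨Q, hQ⟩ := hAB.exists_linearMap B
  have hpos : ∀ ħ, IsPositiveMap (Q ħ) := fun ħ f => by
    refine exists_star_mul_self_eq_of_nonneg B _ ?_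
    have h := hQ ħ (star f * f)
    rw [f.coe_star_mul_self] at h
    exact h.nonneg fun t => by positivity
  have hcont : ∀ D : Set Planck, (∀ ħ ∈ D, ∃ C : ℝ, ∀ᶠ ħ' in 𝓝[D] ħ, ‖A ħ' Set.univ‖ ≤ C) →
      ∀ f, ContinuousOn (fun ħ => Q ħ f) D := fun D hD f => by
    rw [IsInducing.subtypeVal.continuousOn_iff]
    exact hA.continuousOn_integral (fun ħ => hQ ħ f) hD
  have hmul : ∀ f g, Tendsto (fun ħ => ‖Q ħ (f * g) - Q ħ f * Q ħ g‖) Planck.toZero (𝓝 0) :=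
    fun f g => by
      have h := (hA.tendsto_defect (fun ħ => hQ ħ f) (fun ħ => hQ ħ g) fun ħ => hQ ħ (f * g)).norm
      rw [norm_zero] at h
      exact h
  have hnorm : ∀ f, Tendsto (fun ħ => ‖Q ħ f‖) Planck.toZero (𝓝 ‖f‖) := fun f =>
    hA.tendsto_norm_integral hinj (fun ħ => hQ ħ f) fun ħ => hQ ħ (star f * f)
  have hbdd := hA.eventually_norm_lt one_lt_two
  -- Below this `ħ₀` all total masses are less than `2`, so one interval of continuity serves every
  -- `f`.
  obtain ⟨ħ₀, hħ₀⟩ := Planck.eventually_toZero.1 hbdd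
  have hcont₀ := hcont (Set.Iic ħ₀) fun ħ _ =>
    ⟨2, eventually_nhdsWithin_of_forall fun ħ' h => (hħ₀ ħ' h).le⟩
  have hglue : IsGluingFamily Q :=
    { star := fun ħ f => Subtype.ext ((hQ ħ (star f)).unique (hQ ħ f).star)
      bound := by
        refine ⟨4, hbdd.mono fun ħ h f => ?_⟩
        have h1 := (hQ ħ f).norm_le (norm_nonneg f) f.norm_apply_le
        have h2 : 2 * ‖f‖ * ‖A ħ Set.univ‖ ≤ 2 * ‖f‖ * 2 := by gcongr
        exact (h1.trans h2).trans_eq (by ring)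
      continuousOn := ⟨ħ₀, hcont₀⟩
      mul := hmul
      norm := hnorm }
  refine ⟨Q, hQ, ⟨ħ₀, hpos, hcont₀, hmul⟩, fun hloc => ⟨hpos, hcont _ fun ħ _ => ?_, hmul⟩,
    fun f hf => ?_, hnorm, gluedDeformation Q hglue, gluedDeformation_isAssociated Q hglue⟩
  · rw [nhdsWithin_univ]
    exact hloc ħ
  · have h : Tendsto (fun ħ => ‖Q ħ f‖ₑ) Planck.toZero (𝓝 ‖f‖ₑ) := by
      simp only [← ofReal_norm]
      exact (ENNReal.continuous_ofReal.tendsto _).comp (hnorm f)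
    rw [h.liminf_eq]
    exact enorm_pos.2 hf
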